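/- Let $V=\bigoplus_{i\ge 0}\mathbb Q\,b_i$, let $\bigwedge V$ be its exterior algebra, and for a partition $\lambda=(\lambda_1\ge\dots\ge\lambda_r\ge 0)$ of length at most $r$ put $[\mathbf b]^r_\lambda=b_{r-1+\lambda_1}\wedge b_{r-2+\lambda_2}\wedge\dots\wedge b_{\lambda_r}\in\bigwedge^rV$ (these form a basis of $\bigwedge^r V$). Let $w_1,\dots,w_k$ be indeterminates; all maps below are extended linearly to coefficients in $\mathbb Q[w_1^{\pm1},\dots,w_k^{\pm1}]$. Let $\overline\sigma_+(z)=\sum_{i\ge 0}(-1)^i\,\overline\sigma_i z^i:\bigwedge V\to\bigwedge V[z]$ be the algebra homomorphism with $\overline\sigma_+(z)b_j=b_j-b_{j+1}z$, and $\overline\sigma_+(\mathbf w_k)=\overline\sigma_+(w_1)\cdots\overline\sigma_+(w_k)$. For $n\ge 0$ let $B_n=\mathbb Q[e_1,\dots,e_n]$ act on $\bigwedge^nV$ by letting $e_i$ act as $\overline\sigma_i$, and let $H_n=(h_j)_{j\in\mathbb Z}$ be given by $\sum_{j}h_jz^j=1/(1-e_1z+\dots+(-1)^ne_nz^n)$.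 Let $\sigma_-(\mathbf w_k)H_n=\sigma_-(w_1)\cdots\sigma_-(w_k)H_n$, where $\sigma_-(w)$ sends a sequence $(a_j)_{j\in\mathbb Z}$ with $a_j=0$ for $j<0$ to $\bigl(\sum_{i\ge 0}a_{j-i}w^{-i}\bigr)_{j\in\mathbb Z}$, and for a sequence $a=(a_j)_{j\in\mathbb Z}$ let $\Delta_\lambda(a)=\det(a_{\lambda_j-j+i})_{1\le i,j\le r}$. The vertex operator $\Gamma^*(\mathbf w_k)$ on $\bigwedge V$ is the linear map with $$\Gamma^*(\mathbf w_k)[\mathbf b]^r_\lambda=\overline\sigma_+(\mathbf w_k)\Bigl(\Delta_\lambda\bigl(\sigma_-(\mathbf w_k)H_{r-k}\bigr)\,[\mathbf b]^{r-k}_0\Bigr)\quad(k\le r),\qquad \Gamma^*(\mathbf w_k)[\mathbf b]^r_\lambda=0\quad(k>r).$$ **Proposition.** For all $k,r\ge 0$ and every partition $\lambda$ of length at most $r$, $\Gamma^*(\mathbf w_k)[\mathbf b]^r_\lambda$ lies in $\bigwedge^{r-k}V\otimes\mathbb Q[w_1^{\pm1},\dots,w_k^{\pm1}]$ (it is $0$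 if $k>r$), and $$\prod_{1\le i<j\le k}(w_j-w_i)\cdot\Gamma^*(\mathbf w_k)[\mathbf b]^r_\lambda=(w_1\cdots w_k)^{r-1}\begin{vmatrix} w_1^{-(r-1+\lambda_1)}&w_1^{-(r-2+\lambda_2)}&\cdots&w_1^{-\lambda_r}\\ \vdots&\vdots&&\vdots\\ w_k^{-(r-1+\lambda_1)}&w_k^{-(r-2+\lambda_2)}&\cdots&w_k^{-\lambda_r}\\ b_{r-1+\lambda_1}&b_{r-2+\lambda_2}&\cdots&b_{\lambda_r}\end{vmatrix}.$$ Here the determinant stands for its Laplace expansion along the top $k$ rows, $$\sum_{S\subseteq\{1,\dots,r\},\ |S|=k}(-1)^{\sum_{i=1}^k i+\sum_{j\in S}j}\,\det\bigl(w_i^{-(r-j+\lambda_j)}\bigr)_{1\le i\le k,\ j\in S}\ \bigwedge_{j\notin S}b_{r-j+\lambda_j},$$ with the elements of $S$ and of its complement taken in increasing order. -/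

import Mathlib

open scoped BigOperators

noncomputable section

namespace VertexOp

/-! ### The vector space `V`, its exterior algebra and partitions -/

/-- `V = ⊕_{i ≥ 0} A b_i`, with coefficients extended from `ℚ` to a commutative `ℚ`-algebra `A`.
Its exterior algebra over `A` is `⋀V` with coefficients extended to `A`. -/
abbrev V (A : Type) [CommRing A] : Type := ℕ →₀ A

/-- `⋀V` with coefficients in `A`. -/
abbrev Ext (A : Type) [CommRing A] : Type := ExteriorAlgebra A (V A)

/-- Partitions of length at most `r`: weakly decreasing sequences `λ_1 ≥ ... ≥ λ_r ≥ 0`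
(the index `j : Fin r` stands for the position `j + 1`). -/
abbrev Part (r : ℕ) : Type := {l : Fin r → ℕ // Antitone l}

/-- The strictly decreasing exponents `r - j + λ_j`, `j = 1, ..., r`
(`j.rev` is `r - 1 - j` for `j : Fin r`). -/
def expo {r : ℕ} (l : Fin r → ℕ) (j : Fin r) : ℕ := (j.rev : ℕ) + l j

section Coefficients

variable (A : Type) [CommRing A]

/-- The basis vector `b_i` of `V`. -/
def b (i : ℕ) : V A := Finsupp.single i 1

/-- `[b]^r_λ = b_{r-1+λ_1} ∧ b_{r-2+λ_2} ∧ ... ∧ b_{λ_r}`. -/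
def bWedge (r : ℕ) (l : Fin r → ℕ) : Ext A :=
  ExteriorAlgebra.ιMulti A r fun j => b A (expo l j)

/-- Partitions of length at most `r` correspond to strictly decreasing sequences
of `r` natural numbers through `λ ↦ (r - j + λ_j)_j`. -/
def partEquiv (r : ℕ) : (Fin r ↪o ℕᵒᵈ) ≃ Part r where
  toFun f := ⟨fun j => OrderDual.ofDual (f j) - (j.rev : ℕ), by
    have key : ∀ (d : ℕ) (i j : Fin r), (j : ℕ) = i + d →
        OrderDual.ofDual (f j) + d ≤ OrderDual.ofDual (f i) := by
      intro d
      induction d with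
      | zero =>
        intro i j h
        have : i = j := Fin.ext (by omega)
        subst this
        simp
      | succ d ih =>
        intro i j h
        have hlt : (i : ℕ) + d < r := by omega
        have h1 := ih i ⟨i + d, hlt⟩ rfl
        have h2 : f ⟨i + d, hlt⟩ < f j := f.strictMono (Fin.lt_def.2 (by simp; omega))
        have h3 : OrderDual.ofDual (f j) < OrderDual.ofDual (f ⟨i + d, hlt⟩) := h2
        omega
    intro i j hij
    have h := key (j - i) i j (by have : (i : ℕ) ≤ j := hij; omega)
    simp only [Fin.val_rev]
    omega⟩
  invFun l := OrderEmbedding.ofStrictMono (fun j => OrderDual.toDual (expo l.1 j)) (by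
    intro i j hij
    have h := l.2 hij.le
    have h' : (i : ℕ) < j := hij
    show expo l.1 j < expo l.1 i
    simp only [expo, Fin.val_rev]
    omega)
  left_inv f := by
    have key : ∀ (d : ℕ) (j : Fin r), (j.rev : ℕ) = d → d ≤ OrderDual.ofDual (f j) := by
      intro d
      induction d with
      | zero => intro j _; exact Nat.zero_le _
      | succ d ih =>
        intro j h
        simp only [Fin.val_rev] at h
        have hlt : (j : ℕ) + 1 < r := by omega
        have h1 := ih ⟨j + 1, hlt⟩ (by simp only [Fin.val_rev]; omega)
        have h2 : f j < f ⟨j + 1, hlt⟩ := f.strictMono (Fin.lt_def.2 (by simp))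
        have h3 : OrderDual.ofDual (f ⟨j + 1, hlt⟩) < OrderDual.ofDual (f j) := h2
        omega
    ext j
    show expo _ j = OrderDual.ofDual (f j)
    have := key _ j rfl
    simp only [expo]
    omega
  right_inv l := by
    apply Subtype.ext
    funext j
    show expo l.1 j - (j.rev : ℕ) = l.1 j
    simp [expo]

/-- The basis `([b]^r_λ)_λ` of `⋀^r V`, indexed by the partitions of length at most `r`. -/
def wedgeBasis (r : ℕ) : Module.Basis (Part r) A (⋀[A]^r (V A)) :=
  (((Finsupp.basisSingleOne (R := A) (ι := ℕ)).reindex OrderDual.toDual).exteriorPower r).reindex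
    (Set.powersetCard.ofFinEmbEquiv.symm.trans (partEquiv r))

theorem wedgeBasis_apply (r : ℕ) (l : Part r) :
    (wedgeBasis A r l : Ext A) = bWedge A r l.1 := by
  simp only [wedgeBasis, Module.Basis.reindex_apply, exteriorPower.basis_apply,
    exteriorPower.ιMulti_family, exteriorPower.ιMulti_apply_coe, bWedge]
  congr 1
  funext j
  simp only [partEquiv, b, Function.comp_apply, Module.Basis.reindex_apply, Equiv.symm_trans_apply,
    Equiv.symm_symm, Equiv.symm_apply_apply, Finsupp.coe_basisSingleOne]
  rfl

end Coefficients

/-! ### Schubert derivations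

A Hasse-Schmidt derivation `D(z)` on `⋀V` is an algebra homomorphism from `⋀V` to
power series with coefficients in `⋀V`; it is determined by its restriction to `V`. -/

section Schubert

variable (A : Type) [CommRing A]

/-- `σ_1 : V → V`, `b_j ↦ b_{j+1}`. -/
def shift : V A →ₗ[A] V A := Finsupp.lmapDomain A A Nat.succ

theorem shift_b (j : ℕ) : shift A (b A j) = b A (j + 1) := by
  simp [shift, b, Finsupp.lmapDomain_apply, Finsupp.mapDomain_single]

/-- `v ↦ v - σ_1 v · z`. -/
def barPlusOnV : V A →ₗ[A] Polynomial (Ext A) :=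
  (Polynomial.monomial 0).restrictScalars A ∘ₗ ExteriorAlgebra.ι A -
    (Polynomial.monomial 1).restrictScalars A ∘ₗ ExteriorAlgebra.ι A ∘ₗ shift A

/-- `b_j ↦ ∑_{i ≤ j} b_{j-i} z^{-i}`; the variable of the polynomial ring is `z^{-1}`. -/
def minusOnV : V A →ₗ[A] Polynomial (Ext A) :=
  Finsupp.linearCombination A fun j =>
    ∑ i ∈ Finset.range (j + 1), Polynomial.monomial i (ExteriorAlgebra.ι A (b A (j - i)))

theorem sq_eq_zero_of_coeff [Algebra ℚ A] (p : Polynomial (Ext A))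
    (h : ∀ i, p.coeff i ∈ LinearMap.range (ExteriorAlgebra.ι A (M := V A))) : p * p = 0 := by
  ext n
  rw [Polynomial.coeff_mul, Polynomial.coeff_zero]
  set S := ∑ x ∈ Finset.HasAntidiagonal.antidiagonal n, p.coeff x.1 * p.coeff x.2 with hS
  have h1 : S = ∑ x ∈ Finset.HasAntidiagonal.antidiagonal n, p.coeff x.2 * p.coeff x.1 := by
    rw [hS, ← Finset.Nat.sum_antidiagonal_swap]
    rfl
  have h2 : S + S = 0 := by
    conv_lhs => rw [h1]; arg 1; rw [← h1, hS]
    rw [← Finset.sum_add_distrib]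
    apply Finset.sum_eq_zero
    intro x _
    obtain ⟨u, hu⟩ := h x.1
    obtain ⟨v, hv⟩ := h x.2
    rw [← hu, ← hv]
    exact ExteriorAlgebra.ι_add_mul_swap u v
  have h3 : (2 : A) • S = 0 := by rw [two_smul]; exact h2
  have h4 : algebraMap ℚ A (1 / 2) * 2 = 1 := by
    rw [← map_ofNat (algebraMap ℚ A) 2, ← map_mul]
    norm_num
  rw [← one_smul A S, ← h4, mul_smul, h3, smul_zero]

variable [Algebra ℚ A]

theorem barPlusOnV_sq (v : V A) : barPlusOnV A v * barPlusOnV A v = 0 := by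
  apply sq_eq_zero_of_coeff
  intro i
  simp only [barPlusOnV, LinearMap.sub_apply, LinearMap.comp_apply, Polynomial.coeff_sub,
    LinearMap.coe_restrictScalars, Polynomial.coeff_monomial]
  apply Submodule.sub_mem
  · split_ifs
    · exact ⟨_, rfl⟩
    · exact Submodule.zero_mem _
  · split_ifs
    · exact ⟨_, rfl⟩
    · exact Submodule.zero_mem _

theorem minusOnV_sq (v : V A) : minusOnV A v * minusOnV A v = 0 := by
  apply sq_eq_zero_of_coeff
  intro i
  rw [minusOnV, Finsupp.linearCombination_apply, Finsupp.sum, Polynomial.finsetSum_coeff]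
  apply Submodule.sum_mem
  intro j _
  rw [Polynomial.coeff_smul, Polynomial.finsetSum_coeff]
  apply Submodule.smul_mem
  apply Submodule.sum_mem
  intro m _
  rw [Polynomial.coeff_monomial]
  split_ifs
  · exact ⟨_, rfl⟩
  · exact Submodule.zero_mem _

/-- The Schubert derivation `\overline σ_+(z) : ⋀V → ⋀V[z]`, the Hasse-Schmidt derivation with
`\overline σ_+(z) b_j = b_j - b_{j+1} z`. -/
def barPlusHS : Ext A →ₐ[A] Polynomial (Ext A) :=
  ExteriorAlgebra.lift A ⟨barPlusOnV A, barPlusOnV_sq A⟩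

/-- The Schubert derivation `σ_-(z) : ⋀V → ⋀V[z⁻¹]`, the Hasse-Schmidt derivation with
`σ_-(z) b_j = ∑_{i ≥ 0} b_{j-i} z^{-i}` (where `b_m = 0` for `m < 0`). -/
def minusHS : Ext A →ₐ[A] Polynomial (Ext A) :=
  ExteriorAlgebra.lift A ⟨minusOnV A, minusOnV_sq A⟩

/-- Substitution of a scalar `c ∈ A` for the variable. -/
def evalAt (c : A) : Polynomial (Ext A) →ₐ[A] Ext A :=
  Polynomial.eval₂AlgHom (AlgHom.id A (Ext A)) (algebraMap A (Ext A) c)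
    fun a => (Algebra.commutes c a).symm

/-- `\overline σ_+(w) : ⋀V → ⋀V`, for `w ∈ A`. -/
def barPlus (w : A) : Ext A →ₐ[A] Ext A := (evalAt A w).comp (barPlusHS A)

/-- `σ_-(w) : ⋀V → ⋀V`, where `c ∈ A` is the value of `w⁻¹`. -/
def minus (c : A) : Ext A →ₐ[A] Ext A := (evalAt A c).comp (minusHS A)

/-- The endomorphisms `\overline σ_i` of `⋀V`, with
`\overline σ_+(z) = ∑_i (-1)^i \overline σ_i z^i`. -/
def barSigma (i : ℕ) : Module.End A (Ext A) :=
  (-1 : A) ^ i • (Polynomial.lcoeff (Ext A) i).restrictScalars A ∘ₗ (barPlusHS A).toLinearMap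

theorem barSigma_apply (i : ℕ) (u : Ext A) :
    barSigma A i u = (-1 : A) ^ i • (barPlusHS A u).coeff i := rfl

theorem barPlusHS_ι (v : V A) : barPlusHS A (ExteriorAlgebra.ι A v) =
    Polynomial.monomial 0 (ExteriorAlgebra.ι A v) -
      Polynomial.monomial 1 (ExteriorAlgebra.ι A (shift A v)) := by
  simp [barPlusHS, barPlusOnV]

theorem coeff_comm (u : Ext A) : ∀ i j : ℕ,
    (barPlusHS A ((barPlusHS A u).coeff j)).coeff i =
      (barPlusHS A ((barPlusHS A u).coeff i)).coeff j := by
  induction u using ExteriorAlgebra.induction with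
  | algebraMap a =>
    intro i j
    simp only [AlgHom.commutes, Polynomial.algebraMap_apply, Polynomial.coeff_C]
    split_ifs <;> simp [Polynomial.algebraMap_apply, Polynomial.coeff_C, *]
  | ι v =>
    intro i j
    simp only [barPlusHS_ι, Polynomial.coeff_sub, Polynomial.coeff_monomial]
    rcases i with _ | _ | i <;> rcases j with _ | _ | j <;>
      simp [barPlusHS_ι, Polynomial.coeff_monomial]
  | mul u v hu hv =>
    intro i j
    simp only [map_mul, Polynomial.coeff_mul, map_sum, Polynomial.finsetSum_coeff]
    rw [Finset.sum_comm]
    refine Finset.sum_congr rfl fun x _ => Finset.sum_congr rfl fun y _ => ?_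
    rw [hu, hv]
  | add u v hu hv =>
    intro i j
    simp only [map_add, Polynomial.coeff_add, hu, hv]

theorem barSigma_comm (i j : ℕ) : barSigma A i * barSigma A j = barSigma A j * barSigma A i := by
  refine LinearMap.ext fun u => ?_
  simp only [Module.End.mul_apply, barSigma_apply, map_smul]
  rw [coeff_comm, smul_comm]

end Schubert

/-! ### The polynomial ring `B_n`, its action on `⋀V`, and Schur determinants -/

section Bosons

open scoped IsMulCommutative

variable (A : Type) [CommRing A]

/-- `B_n = ℚ[e_1, ..., e_n]` with coefficients extended to `A`; the index `i : Fin n` of a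
variable stands for `e_{i+1}`. -/
abbrev B (n : ℕ) : Type := MvPolynomial (Fin n) A

/-- `E_n(z) = 1 - e_1 z + ... + (-1)^n e_n z^n`. -/
def E (n : ℕ) : PowerSeries (B A n) :=
  1 + ∑ i : Fin n, PowerSeries.monomial ((i : ℕ) + 1) ((-1) ^ ((i : ℕ) + 1) * MvPolynomial.X i)

/-- The sequence `H_n = (h_j)_{j ∈ ℤ}`, with `∑_j h_j z^j = 1 / E_n(z)`. -/
def H (n : ℕ) (j : ℤ) : B A n :=
  if j < 0 then 0 else PowerSeries.coeff j.toNat (PowerSeries.invOfUnit (E A n) 1)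

/-- The action of `σ_-(w)` on a sequence `(a_j)_{j ∈ ℤ}` with `a_j = 0` for `j < 0`:
`a_j ↦ ∑_{i ≥ 0} a_{j-i} w^{-i}`, where `c` is the value of `w⁻¹`. -/
def minusSeq (n : ℕ) (c : A) (a : ℤ → B A n) (j : ℤ) : B A n :=
  ∑ i ∈ Finset.range (j.toNat + 1), c ^ i • a (j - i)

/-- `Δ_λ(a) = det (a_{λ_j - j + i})_{1 ≤ i, j ≤ r}`. -/
def schurDet {n r : ℕ} (l : Fin r → ℕ) (a : ℤ → B A n) : B A n :=
  Matrix.det (Matrix.of fun i j : Fin r => a ((l j : ℤ) - (j : ℤ) + (i : ℤ)))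

theorem bWedge_succ (m p : ℕ) :
    bWedge A (m + 1) (Fin.cons p fun _ => 0) =
      ExteriorAlgebra.ι A (b A (m + p)) * bWedge A m fun _ => 0 := by
  rw [bWedge, bWedge, ExteriorAlgebra.ιMulti_succ_apply]
  congr 1
  congr 1
  funext j
  simp [Matrix.vecTail, expo]

theorem bWedge_zero_succ (m : ℕ) :
    bWedge A (m + 1) (fun _ => 0) = ExteriorAlgebra.ι A (b A m) * bWedge A m fun _ => 0 := by
  have h := bWedge_succ A m 0
  rw [add_zero] at h
  rw [← h]
  congr 1
  funext j
  refine Fin.cases ?_ (fun i => ?_) j <;> simp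

theorem ι_mul_bWedge_zero {m j : ℕ} (h : j < m) :
    ExteriorAlgebra.ι A (b A j) * bWedge A m (fun _ => 0) = 0 := by
  induction m with
  | zero => omega
  | succ m ih =>
    rw [bWedge_zero_succ, ← mul_assoc]
    rcases Nat.lt_succ_iff_lt_or_eq.1 h with h' | rfl
    · rw [eq_neg_of_add_eq_zero_left (ExteriorAlgebra.ι_add_mul_swap (b A j) (b A m)),
        neg_mul, mul_assoc, ih h', mul_zero, neg_zero]
    · rw [ExteriorAlgebra.ι_sq_zero, zero_mul]

theorem H_nat (n j : ℕ) :
    H A n j = PowerSeries.coeff j (PowerSeries.invOfUnit (E A n) 1) := by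
  simp [H]

theorem E_mul_H (n : ℕ) : E A n * PowerSeries.invOfUnit (E A n) 1 = 1 := by
  apply PowerSeries.mul_invOfUnit
  rw [E, map_add, map_sum, map_one, Units.val_one, Finset.sum_eq_zero, add_zero]
  intro i _
  rw [← PowerSeries.coeff_zero_eq_constantCoeff_apply, PowerSeries.coeff_monomial]
  simp

variable [Algebra ℚ A]

/-- The action of `B_n` on `⋀V`, in which `e_i` acts as `\overline σ_i`. -/
def act (n : ℕ) : B A n →ₐ[A] Module.End A (Ext A) :=
  haveI : IsMulCommutative (Algebra.adjoin A (Set.range (barSigma A))) :=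
    Algebra.isMulCommutative_adjoin A (by
      rintro _ ⟨i, rfl⟩ _ ⟨j, rfl⟩
      exact barSigma_comm A i j)
  (Subalgebra.val (Algebra.adjoin A (Set.range (barSigma A)))).comp
    (MvPolynomial.aeval fun i : Fin n =>
      (⟨barSigma A ((i : ℕ) + 1), Algebra.subset_adjoin ⟨_, rfl⟩⟩ :
        Algebra.adjoin A (Set.range (barSigma A))))

theorem act_X (n : ℕ) (i : Fin n) :
    act A n (MvPolynomial.X i) = barSigma A ((i : ℕ) + 1) := by
  simp [act]

/-! The formula for `σ_-(w) h_j` used in `minusSeq` agrees with the operator on `B_n`, `n ≥ 1`,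
that is induced by the Schubert derivation `σ_-(w)` through `p ↦ p [b]^n_0`. -/

theorem minus_b (c : A) (j : ℕ) :
    minus A c (ExteriorAlgebra.ι A (b A j)) =
      ∑ i ∈ Finset.range (j + 1), c ^ i • ExteriorAlgebra.ι A (b A (j - i)) := by
  simp only [minus, AlgHom.comp_apply, minusHS, ExteriorAlgebra.lift_ι_apply, minusOnV, b,
    Finsupp.linearCombination_single, one_smul, map_sum]
  refine Finset.sum_congr rfl fun i _ => ?_
  show Polynomial.eval₂ _ _ _ = _
  rw [Polynomial.eval₂_monomial, ← map_pow, Algebra.smul_def, Algebra.commutes]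
  rfl

theorem minus_bWedge_zero (c : A) (m : ℕ) :
    minus A c (bWedge A m fun _ => 0) = bWedge A m fun _ => 0 := by
  induction m with
  | zero => simp [bWedge]
  | succ m ih =>
    rw [bWedge_zero_succ, map_mul, ih, minus_b, Finset.sum_mul, Finset.sum_eq_single 0]
    · simp
    · intro i hi hi0
      rw [smul_mul_assoc, ι_mul_bWedge_zero A (by simp at hi; omega), smul_zero]
    · simp

theorem minus_bWedge_succ (c : A) (m p : ℕ) :
    minus A c (bWedge A (m + 1) (Fin.cons p fun _ => 0)) =
      ∑ i ∈ Finset.range (p + 1), c ^ i • bWedge A (m + 1) (Fin.cons (p - i) fun _ => 0) := by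
  rw [bWedge_succ, map_mul, minus_bWedge_zero, minus_b, Finset.sum_mul]
  symm
  apply Finset.sum_subset_zero_on_sdiff
  · intro i hi
    simp at hi ⊢
    omega
  · intro i hi
    simp at hi
    rw [smul_mul_assoc, ι_mul_bWedge_zero A (by omega), smul_zero]
  · intro i hi
    simp at hi
    rw [bWedge_succ, smul_mul_assoc]
    congr 4
    omega

theorem barPlusHS_b (j : ℕ) : barPlusHS A (ExteriorAlgebra.ι A (b A j)) =
    Polynomial.monomial 0 (ExteriorAlgebra.ι A (b A j)) -
      Polynomial.monomial 1 (ExteriorAlgebra.ι A (b A (j + 1))) := by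
  rw [barPlusHS_ι, shift_b]

theorem coeff_barPlusHS_b_mul (j i : ℕ) (u : Ext A) :
    (barPlusHS A (ExteriorAlgebra.ι A (b A j) * u)).coeff (i + 1) =
      ExteriorAlgebra.ι A (b A j) * (barPlusHS A u).coeff (i + 1) -
        ExteriorAlgebra.ι A (b A (j + 1)) * (barPlusHS A u).coeff i := by
  rw [map_mul, barPlusHS_b, sub_mul, Polynomial.coeff_sub, Polynomial.monomial_zero_left,
    Polynomial.coeff_C_mul, Polynomial.coeff_monomial_mul]

theorem coeff_zero_barPlusHS (u : Ext A) : (barPlusHS A u).coeff 0 = u := by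
  induction u using ExteriorAlgebra.induction with
  | algebraMap a => simp [Polynomial.algebraMap_apply]
  | ι v => simp [barPlusHS_ι, Polynomial.coeff_monomial]
  | mul u v hu hv => rw [map_mul, Polynomial.mul_coeff_zero, hu, hv]
  | add u v hu hv => rw [map_add, Polynomial.coeff_add, hu, hv]

theorem coeff_barPlusHS_bWedge_zero (m i : ℕ) (h : m < i) :
    (barPlusHS A (bWedge A m fun _ => 0)).coeff i = 0 := by
  induction m generalizing i with
  | zero =>
    rw [bWedge, ExteriorAlgebra.ιMulti_zero_apply, map_one, Polynomial.coeff_one]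
    simp; omega
  | succ m ih =>
    obtain ⟨i, rfl⟩ : ∃ i', i = i' + 1 := ⟨i - 1, by omega⟩
    rw [bWedge_zero_succ, coeff_barPlusHS_b_mul, ih _ (by omega), ih _ (by omega)]
    simp

theorem ι_mul_coeff_barPlusHS (m i : ℕ) :
    ExteriorAlgebra.ι A (b A m) * (barPlusHS A (bWedge A m fun _ => 0)).coeff (i + 1) = 0 := by
  induction m generalizing i with
  | zero =>
    rw [bWedge, ExteriorAlgebra.ιMulti_zero_apply, map_one, Polynomial.coeff_one]
    simp
  | succ m ih =>
    rw [bWedge_zero_succ, coeff_barPlusHS_b_mul, mul_sub, ih, ← mul_assoc (ExteriorAlgebra.ι A _)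
      (ExteriorAlgebra.ι A _), ExteriorAlgebra.ι_sq_zero]
    simp

theorem act_E (n i : ℕ) (u : Ext A) :
    act A n (PowerSeries.coeff i (E A n)) u =
      if i ≤ n then (barPlusHS A u).coeff i else 0 := by
  rw [E, map_add, map_sum, PowerSeries.coeff_one]
  rcases i with _ | i
  · simp [PowerSeries.coeff_monomial, coeff_zero_barPlusHS]
  · by_cases h : i < n
    · rw [if_pos (Nat.succ_le_of_lt h), if_neg (Nat.succ_ne_zero i), zero_add,
        Finset.sum_eq_single (⟨i, h⟩ : Fin n)]
      · have e : (-1 : B A n) ^ (i + 1) * MvPolynomial.X (⟨i, h⟩ : Fin n) =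
            (-1 : A) ^ (i + 1) • MvPolynomial.X (⟨i, h⟩ : Fin n) := by
          rw [Algebra.smul_def, map_pow, map_neg, map_one]
        rw [PowerSeries.coeff_monomial, if_pos rfl, e, map_smul, act_X,
          LinearMap.smul_apply, barSigma_apply, smul_smul, ← mul_pow]
        simp
      · intro j _ hj
        rw [PowerSeries.coeff_monomial, if_neg]
        intro h'
        apply hj
        ext
        simp at h' ⊢
        omega
      · simp
    · rw [if_neg (Nat.succ_ne_zero i), if_neg (by omega), zero_add, Finset.sum_eq_zero]
      · simp
      · intro j _
        rw [PowerSeries.coeff_monomial, if_neg]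
        have := j.2
        omega

/-- `h_p [b]^n_0 = [b]^n_{(p)}` for `n = m + 1 ≥ 1`. -/
theorem act_H (m p : ℕ) :
    act A (m + 1) (H A (m + 1) p) (bWedge A (m + 1) fun _ => 0) =
      bWedge A (m + 1) (Fin.cons p fun _ => 0) := by
  induction p using Nat.strong_induction_on with
  | _ p ih =>
  rcases p with _ | p
  · rw [H_nat, PowerSeries.coeff_zero_eq_constantCoeff_apply, PowerSeries.constantCoeff_invOfUnit,
      inv_one, Units.val_one, map_one, Module.End.one_apply, bWedge_succ, bWedge_zero_succ,
      add_zero]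
  · have h := congrArg (fun f => act A (m + 1) (PowerSeries.coeff (p + 1) f)
      (bWedge A (m + 1) fun _ => 0)) (E_mul_H A (m + 1))
    simp only [PowerSeries.coeff_mul, PowerSeries.coeff_one, map_sum, LinearMap.sum_apply, map_mul,
      Module.End.mul_apply, Nat.succ_ne_zero, if_false, map_zero, LinearMap.zero_apply,
      ← H_nat] at h
    rw [Finset.Nat.sum_antidiagonal_succ, act_E, if_pos (Nat.zero_le _),
      coeff_zero_barPlusHS] at h
    have hF : ∀ x ∈ Finset.HasAntidiagonal.antidiagonal p,
        act A (m + 1) (PowerSeries.coeff (x.1 + 1) (E A (m + 1)))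
            (act A (m + 1) (H A (m + 1) x.2) (bWedge A (m + 1) fun _ => 0)) =
          ExteriorAlgebra.ι A (b A (m + x.2)) *
              (barPlusHS A (bWedge A m fun _ => 0)).coeff (x.1 + 1) -
            ExteriorAlgebra.ι A (b A (m + (x.2 + 1))) *
              (barPlusHS A (bWedge A m fun _ => 0)).coeff x.1 := by
      intro x hx
      rw [Finset.HasAntidiagonal.mem_antidiagonal] at hx
      rw [ih x.2 (by omega), bWedge_succ, act_E, coeff_barPlusHS_b_mul]
      split_ifs with hle
      · rfl
      · rw [coeff_barPlusHS_bWedge_zero A m (x.1 + 1) (by omega),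
          coeff_barPlusHS_bWedge_zero A m x.1 (by omega)]
        simp
    rw [Finset.sum_congr rfl hF, Finset.sum_sub_distrib] at h
    have h1 := Finset.Nat.sum_antidiagonal_succ (n := p)
      (f := fun x => ExteriorAlgebra.ι A (b A (m + x.2)) *
        (barPlusHS A (bWedge A m fun _ => 0)).coeff x.1)
    have h2 := Finset.Nat.sum_antidiagonal_succ' (n := p)
      (f := fun x => ExteriorAlgebra.ι A (b A (m + x.2)) *
        (barPlusHS A (bWedge A m fun _ => 0)).coeff x.1)
    rw [h1] at h2
    simp only [add_zero, ι_mul_coeff_barPlusHS, coeff_zero_barPlusHS, zero_add] at h2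
    rw [bWedge_succ]
    rw [← h2, sub_add_cancel_right, add_neg_eq_zero] at h
    exact h

/-- `(σ_-(w) h_p) [b]^n_0 = σ_-(w) [b]^n_{(p)}` for `n = m + 1 ≥ 1`. -/
theorem act_minusSeq (c : A) (m p : ℕ) :
    act A (m + 1) (minusSeq A (m + 1) c (H A (m + 1)) p) (bWedge A (m + 1) fun _ => 0) =
      minus A c (bWedge A (m + 1) (Fin.cons p fun _ => 0)) := by
  rw [minus_bWedge_succ, minusSeq, map_sum, LinearMap.sum_apply, Int.toNat_natCast]
  refine Finset.sum_congr rfl fun i hi => ?_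
  rw [map_smul, LinearMap.smul_apply, ← Nat.cast_sub (by simp at hi; omega), act_H]

end Bosons

/-! ### Laurent polynomials, the vertex operator and the bordered determinant -/

section Vertex

/-- The ring `ℚ[w_1^{±1}, ..., w_k^{±1}]` of Laurent polynomials. -/
abbrev Laurent (k : ℕ) : Type := AddMonoidAlgebra ℚ (Fin k → ℤ)

/-- The monomial `w_i^m`, `m ∈ ℤ`. -/
def wPow {k : ℕ} (i : Fin k) (m : ℤ) : Laurent k := AddMonoidAlgebra.single (Pi.single i m) 1

/-- `\overline σ_+(w_1, ..., w_k) = \overline σ_+(w_1) ⋯ \overline σ_+(w_k)`. -/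
def barPlusAll (k : ℕ) : Ext (Laurent k) →ₐ[Laurent k] Ext (Laurent k) :=
  (List.ofFn fun i : Fin k => barPlus (Laurent k) (wPow i 1)).prod

/-- The sequence `σ_-(w_1, ..., w_k) H_n = σ_-(w_1) ⋯ σ_-(w_k) H_n`. -/
def minusAllH (k n : ℕ) : ℤ → B (Laurent k) n :=
  (List.ofFn fun i : Fin k => minusSeq (Laurent k) n (wPow i (-1))).foldr
    (fun T a => T a) (H (Laurent k) n)

/-- The value of `Γ^*(w_1, ..., w_k)` at `[b]^r_λ`:
`\overline σ_+(w_1, ..., w_k) (Δ_λ(σ_-(w_1, ..., w_k) H_{r-k}) [b]^{r-k}_0)`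
if `k ≤ r`, and `0` if `k > r`. -/
def gammaStarValue (k r : ℕ) (l : Part r) : Ext (Laurent k) :=
  if k ≤ r then
    barPlusAll k (act (Laurent k) (r - k) (schurDet (Laurent k) l.1 (minusAllH k (r - k)))
      (bWedge (Laurent k) (r - k) fun _ => 0))
  else 0

/-- The vertex operator `Γ^*(w_1, ..., w_k)` on `⋀V` (with Laurent polynomial coefficients):
the linear map with the prescribed values on the basis `([b]^r_λ)_{r, λ}`. -/
def gammaStar (k : ℕ) : Ext (Laurent k) →ₗ[Laurent k] Ext (Laurent k) :=
  DirectSum.toModule (Laurent k) ℕ (Ext (Laurent k))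
      (fun r => (wedgeBasis (Laurent k) r).constr (Laurent k) (gammaStarValue k r)) ∘ₗ
    (DirectSum.decomposeLinearEquiv fun r : ℕ => ⋀[Laurent k]^r (V (Laurent k))).toLinearMap

theorem gammaStar_bWedge (k r : ℕ) (l : Part r) :
    gammaStar k (bWedge (Laurent k) r l.1) = gammaStarValue k r l := by
  rw [← wedgeBasis_apply]
  simp only [gammaStar, LinearMap.comp_apply, LinearEquiv.coe_coe,
    DirectSum.decomposeLinearEquiv_apply, DirectSum.decompose_coe]
  rw [← DirectSum.lof_eq_of (Laurent k), DirectSum.toModule_lof, Module.Basis.constr_basis]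

/-- The determinant with values in `⋀^{r-k} V` whose top `k` rows are the rows of the scalar
matrix `M` and whose bottom row is the row of vectors `v_1, ..., v_r`: its Laplace expansion along
the top `k` rows. For each set `S` of `k` columns, the `k × k` minor of `M` on the
columns in `S` multiplies the wedge product of the `v_j` with `j ∉ S`, in increasing order of `j`,
with the sign `(-1)^(sum of the k row indices + sum of the k column indices)`. -/
def borderedDet {A : Type} [CommRing A] {k r : ℕ} (M : Matrix (Fin k) (Fin r) A)
    (v : Fin r → V A) : Ext A :=
  ∑ S : Set.powersetCard (Fin r) k,
    ((-1) ^ (∑ i : Fin k, (i : ℕ) + ∑ j ∈ S.1, (j : ℕ)) *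
        (M.submatrix id (S.1.orderEmbOfFin S.2)).det) •
      ExteriorAlgebra.ιMulti A (r - k) fun j : Fin (r - k) =>
        v ((S.1ᶜ).orderEmbOfFin
          (by rw [Finset.card_compl, Fintype.card_fin, Set.powersetCard.card_eq S]) j)

end Vertex

end VertexOp

end

/-! Both sides are the iterated contraction of $[\mathbf b]^r_\lambda$ with the functionals
$f_i:b_j\mapsto w_i^{-j}$, up to the factor $(w_1\cdots w_k)^{r-1}$.

For the bordered determinant this is the antiderivation rule, applied column by column
(`contractAll_ιMulti`).

For the vertex operator, Giambelli's formula (`bWedge_eq_act_schurDet`) gives $[\mathbf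
b]^r_\lambda=\Delta_\lambda(H_r)[\mathbf b]^r_0$, so two facts about contraction with $f:b_j\mapsto
c^j$ suffice. Since $f\circ\sigma_1=c f$, contraction commutes with $\overline\sigma_+(z)$ up to the
factor $1-cz$. As $E_n(z)$ acts on $\bigwedge^nV$ as $\overline\sigma_+(z)$, contraction from degree
$n+1$ to degree $n$ intertwines the actions of $B_{n+1}$ and $B_n$ through
$E_{n+1}(z)\mapsto(1-cz)E_n(z)$ (`contractLeft_act`), and for $c=w^{-1}$ this sends $H_{n+1}$ to
$\sigma_-(w)H_n$ (`adjoinRoot_H`). Secondly, $w^m$ times the contraction of $[\mathbf b]^{m+1}_0$ is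
$\overline\sigma_+(w)[\mathbf b]^m_0$ (`contractLeft_bWedge_zero`). When this is iterated, later
contractions must pass the earlier $\overline\sigma_+(w_i)$, and the factors $1-w_iw_j^{-1}$
assemble into the Vandermonde product (`contractAll_bWedge_zero`). -/

namespace VertexOp

open CliffordAlgebra (contractLeft contractLeft_ι_mul)
open ExteriorAlgebra (ι)

/-! ### Degrees, and commutation of $\overline\sigma_+(w)$ with the action of $B_n$ -/

section Grading

variable {A : Type} [CommRing A]

theorem ι_mul_mem_exteriorPower {n : ℕ} (v : V A) {u : Ext A} (hu : u ∈ ⋀[A]^n (V A)) :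
    ι A v * u ∈ ⋀[A]^(n + 1) (V A) := by
  have h : ι A v * u ∈ LinearMap.range (ι A (M := V A)) * LinearMap.range (ι A (M := V A)) ^ n :=
    Submodule.mul_mem_mul ⟨v, rfl⟩ hu
  rwa [← pow_succ'] at h

theorem bWedge_mem_exteriorPower (r : ℕ) (l : Fin r → ℕ) : bWedge A r l ∈ ⋀[A]^r (V A) :=
  ExteriorAlgebra.ιMulti_range A r ⟨_, rfl⟩

/-- Induction on the degree for the elements of the exterior powers. -/
theorem exteriorPower_induction {P : ℕ → Ext A → Prop}
    (algebraMap : ∀ a, P 0 (algebraMap A (Ext A) a))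
    (add : ∀ n x y, P n x → P n y → P n (x + y))
    (ι_mul : ∀ n v x, x ∈ ⋀[A]^n (V A) → P n x → P (n + 1) (ι A v * x))
    {n : ℕ} {u : Ext A} (hu : u ∈ ⋀[A]^n (V A)) : P n u := by
  refine Submodule.pow_induction_on_left' (LinearMap.range (ι A (M := V A)))
    (C := fun n x _ => P n x) algebraMap (fun x y n _ _ => add n x y) ?_ hu
  rintro _ ⟨v, rfl⟩ n x hx h
  exact ι_mul n v x hx h

theorem contractLeft_mem_exteriorPower (f : Module.Dual A (V A)) {n : ℕ} {u : Ext A}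
    (hu : u ∈ ⋀[A]^(n + 1) (V A)) : contractLeft f u ∈ ⋀[A]^n (V A) := by
  -- The induction starts in degree 0, which is not of the form $n+1$; the extra clause there is
  -- what the step from degree 0 to degree 1 uses.
  have key : ∀ m : ℕ, u ∈ ⋀[A]^m (V A) → (m = 0 → contractLeft f u = 0) ∧
      ∀ n, m = n + 1 → contractLeft f u ∈ ⋀[A]^n (V A) := by
    intro m hm
    refine exteriorPower_induction (P := fun m u => (m = 0 → contractLeft f u = 0) ∧
      ∀ n, m = n + 1 → contractLeft f u ∈ ⋀[A]^n (V A)) ?_ ?_ ?_ hm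
    · intro a
      exact ⟨fun _ => CliffordAlgebra.contractLeft_algebraMap _ _ _, fun n hn => by omega⟩
    · intro n x y hx hy
      refine ⟨fun h => ?_, fun n h => ?_⟩
      · rw [map_add, hx.1 h, hy.1 h, add_zero]
      · rw [map_add]
        exact Submodule.add_mem _ (hx.2 n h) (hy.2 n h)
    · intro n v x hx ih
      refine ⟨fun h => by omega, fun n' h => ?_⟩
      obtain rfl : n = n' := by omega
      rw [ι, contractLeft_ι_mul]
      refine Submodule.sub_mem _ (Submodule.smul_mem _ _ hx) ?_
      rcases n with _ | n
      · rw [ih.1 rfl, mul_zero]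
        exact Submodule.zero_mem _
      · exact ι_mul_mem_exteriorPower v (ih.2 n rfl)
  exact (key _ hu).2 n rfl

variable [Algebra ℚ A]

theorem coeff_succ_barPlusHS_ι_mul (v : V A) (i : ℕ) (u : Ext A) :
    (barPlusHS A (ι A v * u)).coeff (i + 1) =
      ι A v * (barPlusHS A u).coeff (i + 1) - ι A (shift A v) * (barPlusHS A u).coeff i := by
  rw [map_mul, barPlusHS_ι, sub_mul, Polynomial.coeff_sub, Polynomial.monomial_zero_left,
    Polynomial.coeff_C_mul, Polynomial.coeff_monomial_mul]

theorem coeff_barPlusHS_mem {n : ℕ} {u : Ext A} (hu : u ∈ ⋀[A]^n (V A)) (i : ℕ) :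
    (barPlusHS A u).coeff i ∈ ⋀[A]^n (V A) := by
  revert i
  refine exteriorPower_induction (P := fun n u => ∀ i, (barPlusHS A u).coeff i ∈ ⋀[A]^n (V A))
    ?_ ?_ ?_ hu
  · intro a i
    rw [AlgHom.commutes, Polynomial.algebraMap_apply, Polynomial.coeff_C]
    split_ifs
    · exact Submodule.algebraMap_mem a
    · exact Submodule.zero_mem _
  · intro n x y hx hy i
    rw [map_add, Polynomial.coeff_add]
    exact Submodule.add_mem _ (hx i) (hy i)
  · intro n v x hx ih i
    rcases i with _ | i
    · rw [coeff_zero_barPlusHS]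
      exact ι_mul_mem_exteriorPower v hx
    · rw [coeff_succ_barPlusHS_ι_mul]
      exact Submodule.sub_mem _ (ι_mul_mem_exteriorPower _ (ih _))
        (ι_mul_mem_exteriorPower _ (ih _))

/-- Each of the $n$ vector factors contributes at most one power of $z$. -/
theorem coeff_barPlusHS_eq_zero {n : ℕ} {u : Ext A} (hu : u ∈ ⋀[A]^n (V A)) {i : ℕ}
    (hi : n < i) : (barPlusHS A u).coeff i = 0 := by
  revert i
  refine exteriorPower_induction (P := fun n u => ∀ {i}, n < i → (barPlusHS A u).coeff i = 0)
    ?_ ?_ ?_ hu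
  · intro a i hi
    rw [AlgHom.commutes, Polynomial.algebraMap_apply, Polynomial.coeff_C, if_neg hi.ne']
  · intro n x y hx hy i hi
    rw [map_add, Polynomial.coeff_add, hx hi, hy hi, add_zero]
  · intro n v x hx ih i hi
    obtain ⟨i, rfl⟩ : ∃ i', i = i' + 1 := ⟨i - 1, by omega⟩
    rw [coeff_succ_barPlusHS_ι_mul, ih (by omega), ih (by omega), mul_zero, mul_zero, sub_zero]

/-- On `⋀^n V` the coefficients of `E_n(z)` act as those of `\overline σ_+(z)`. -/
theorem act_coeff_E {n : ℕ} {u : Ext A} (hu : u ∈ ⋀[A]^n (V A)) (i : ℕ) :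
    act A n (PowerSeries.coeff i (E A n)) u = (barPlusHS A u).coeff i := by
  rw [act_E]
  split_ifs with h
  · rfl
  · exact (coeff_barPlusHS_eq_zero hu (by omega)).symm

theorem act_X_apply (n : ℕ) (i : Fin n) (u : Ext A) :
    act A n (MvPolynomial.X i) u = (-1 : A) ^ ((i : ℕ) + 1) • (barPlusHS A u).coeff (i + 1) := by
  rw [act_X, barSigma_apply]

theorem act_C_apply (n : ℕ) (a : A) (u : Ext A) : act A n (MvPolynomial.C a) u = a • u := by
  rw [← MvPolynomial.algebraMap_eq, AlgHom.commutes, Module.algebraMap_end_apply]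

theorem act_mem {n m : ℕ} (p : B A n) {u : Ext A} (hu : u ∈ ⋀[A]^m (V A)) :
    act A n p u ∈ ⋀[A]^m (V A) := by
  induction p using MvPolynomial.induction_on generalizing u with
  | C a =>
    rw [act_C_apply]
    exact Submodule.smul_mem _ _ hu
  | add p q hp hq =>
    rw [map_add, LinearMap.add_apply]
    exact Submodule.add_mem _ (hp hu) (hq hu)
  | mul_X p i hp =>
    rw [map_mul, Module.End.mul_apply, act_X_apply]
    exact hp (Submodule.smul_mem _ _ (coeff_barPlusHS_mem hu _))

theorem barPlus_apply (w : A) (u : Ext A) :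
    barPlus A w u = (barPlusHS A u).sum fun i x => w ^ i • x := by
  show Polynomial.eval₂ _ _ _ = _
  rw [Polynomial.eval₂_eq_sum]
  refine Finset.sum_congr rfl fun i _ => ?_
  show (barPlusHS A u).coeff i * algebraMap A (Ext A) w ^ i = w ^ i • (barPlusHS A u).coeff i
  rw [← map_pow, Algebra.smul_def, Algebra.commutes]

theorem barPlus_ι (w : A) (v : V A) : barPlus A w (ι A v) = ι A v - w • ι A (shift A v) := by
  show evalAt A w (barPlusHS A (ι A v)) = _
  rw [barPlusHS_ι, map_sub]
  show Polynomial.eval₂ _ _ _ - Polynomial.eval₂ _ _ _ = _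
  rw [Polynomial.eval₂_monomial, Polynomial.eval₂_monomial, pow_zero, mul_one, pow_one,
    Algebra.smul_def, Algebra.commutes]
  rfl

theorem barPlus_mem {n : ℕ} (w : A) {u : Ext A} (hu : u ∈ ⋀[A]^n (V A)) :
    barPlus A w u ∈ ⋀[A]^n (V A) := by
  rw [barPlus_apply]
  exact Submodule.sum_mem _ fun i _ => Submodule.smul_mem _ _ (coeff_barPlusHS_mem hu i)

theorem barPlus_eq_sum_range {N : ℕ} (w : A) {u : Ext A}
    (hN : ∀ i, N ≤ i → (barPlusHS A u).coeff i = 0) :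
    barPlus A w u = ∑ i ∈ Finset.range N, w ^ i • (barPlusHS A u).coeff i := by
  rw [barPlus_apply, Polynomial.sum_def]
  refine Finset.sum_subset (fun i hi => ?_) fun i _ hi => ?_
  · rw [Finset.mem_range]
    by_contra h
    exact Polynomial.mem_support_iff.1 hi (hN i (not_lt.1 h))
  · rw [Polynomial.notMem_support_iff.1 hi, smul_zero]

theorem barPlus_coeff_barPlusHS (w : A) (u : Ext A) (i : ℕ) :
    barPlus A w ((barPlusHS A u).coeff i) = (barPlusHS A (barPlus A w u)).coeff i := by
  have h0 : ∀ j, (barPlusHS A u).natDegree + 1 ≤ j → (barPlusHS A u).coeff j = 0 :=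
    fun j hj => Polynomial.coeff_eq_zero_of_natDegree_lt hj
  -- The same truncation works for the $i$-th coefficient of $\overline\sigma_+(z)u$, because
  -- `coeff_comm` turns its $j$-th coefficient into one computed from the vanishing $j$-th
  -- coefficient of `u`.
  rw [barPlus_eq_sum_range w h0, barPlus_eq_sum_range w (N := (barPlusHS A u).natDegree + 1)
    fun j hj => by rw [coeff_comm, h0 j hj, map_zero, Polynomial.coeff_zero], map_sum,
    Polynomial.finsetSum_coeff]
  refine Finset.sum_congr rfl fun j _ => ?_
  rw [map_smul, Polynomial.coeff_smul, coeff_comm]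

/-- All the $\overline\sigma_i$ commute. This lets the Schur determinant be moved past
$\overline\sigma_+(\mathbf w_k)$. -/
theorem barPlus_act (w : A) {n : ℕ} (p : B A n) (u : Ext A) :
    barPlus A w (act A n p u) = act A n p (barPlus A w u) := by
  induction p using MvPolynomial.induction_on generalizing u with
  | C a => rw [act_C_apply, act_C_apply, map_smul]
  | add p q hp hq => rw [map_add, LinearMap.add_apply, map_add, hp, hq, LinearMap.add_apply]
  | mul_X p i hp =>
    rw [map_mul, Module.End.mul_apply, hp, act_X_apply, map_smul, barPlus_coeff_barPlusHS,
      ← act_X_apply, Module.End.mul_apply]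

end Grading

end VertexOp

namespace VertexOp

open ExteriorAlgebra (ι ιMulti)

/-! ### Giambelli's formula -/

section Giambelli

variable {A : Type} [CommRing A]

/-- `det (a_{m_j - (r - i)})_{1 ≤ i, j ≤ r}` for a sequence of exponents `m_1, ..., m_r`. -/
noncomputable def exponentDet {n r : ℕ} (m : Fin r → ℕ) (a : ℤ → B A n) : B A n :=
  Matrix.det (Matrix.of fun i j : Fin r => a ((m j : ℤ) - (i.rev : ℕ)))

theorem exponentDet_expo {n r : ℕ} (l : Fin r → ℕ) (a : ℤ → B A n) :
    exponentDet (expo l) a = schurDet A l a := by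
  rw [exponentDet, schurDet]
  congr 1
  refine Matrix.ext fun i j => ?_
  simp only [Matrix.of_apply, expo]
  refine congrArg a ?_
  have hi := i.val_rev
  have hj := j.val_rev
  omega

theorem exponentDet_comp_perm {n r : ℕ} (m : Fin r → ℕ) (a : ℤ → B A n)
    (σ : Equiv.Perm (Fin r)) :
    exponentDet (m ∘ σ) a = ((Equiv.Perm.sign σ : ℤ) : B A n) * exponentDet m a :=
  Matrix.det_permute' σ (Matrix.of fun i j : Fin r => a ((m j : ℤ) - (i.rev : ℕ)))

theorem H_of_neg (n : ℕ) {j : ℤ} (hj : j < 0) : H A n j = 0 := if_pos hj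

theorem H_zero (n : ℕ) : H A n 0 = 1 := by
  rw [← Nat.cast_zero, H_nat, PowerSeries.coeff_zero_eq_constantCoeff_apply,
    PowerSeries.constantCoeff_invOfUnit, inv_one, Units.val_one]

theorem coeff_zero_E (n : ℕ) : PowerSeries.coeff 0 (E A n) = 1 := by
  rw [E, map_add, map_sum, Finset.sum_eq_zero, add_zero, PowerSeries.coeff_one, if_pos rfl]
  intro i _
  rw [PowerSeries.coeff_monomial, if_neg (by omega)]

theorem coeff_E_of_lt {n i : ℕ} (h : n < i) : PowerSeries.coeff i (E A n) = 0 := by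
  rw [E, map_add, map_sum, Finset.sum_eq_zero, add_zero, PowerSeries.coeff_one,
    if_neg (by omega)]
  intro j _
  rw [PowerSeries.coeff_monomial, if_neg (by omega)]

theorem coeff_succ_E {n i : ℕ} (h : i < n) :
    PowerSeries.coeff (i + 1) (E A n) = (-1) ^ (i + 1) * MvPolynomial.X ⟨i, h⟩ := by
  rw [E, map_add, map_sum, PowerSeries.coeff_one, if_neg (by omega), zero_add,
    Finset.sum_eq_single (⟨i, h⟩ : Fin n)]
  · rw [PowerSeries.coeff_monomial, if_pos rfl]
  · intro j _ hj
    rw [PowerSeries.coeff_monomial, if_neg]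
    intro h'
    exact hj (Fin.ext (by simp only; omega))
  · simp

theorem sum_coeff_E_mul_H (n : ℕ) {j : ℤ} (hj : 0 < j) :
    ∑ s ∈ Finset.range (n + 1), PowerSeries.coeff s (E A n) * H A n (j - s) = 0 := by
  obtain ⟨j, rfl⟩ := Int.eq_ofNat_of_zero_le hj.le
  have h := congrArg (PowerSeries.coeff j) (E_mul_H A n)
  rw [PowerSeries.coeff_mul, PowerSeries.coeff_one, if_neg (by omega),
    Finset.Nat.sum_antidiagonal_eq_sum_range_succ_mk] at h
  have hF : ∀ N, (∀ s, N ≤ s →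
      PowerSeries.coeff s (E A n) * H A n ((j : ℤ) - s) = 0) → ∀ M, N ≤ M →
      ∑ s ∈ Finset.range N, PowerSeries.coeff s (E A n) * H A n ((j : ℤ) - s) =
        ∑ s ∈ Finset.range M, PowerSeries.coeff s (E A n) * H A n ((j : ℤ) - s) := by
    intro N hN M hM
    refine Finset.sum_subset (Finset.range_subset_range.2 hM) fun s _ hs => hN s ?_
    rw [Finset.mem_range] at hs
    omega
  -- The ranges $s\le n$ and $s\le j$ are both extended to a common one: the added terms vanish
  -- through $E_n$ in the first case and through $h$ of negative index in the second.
  rw [hF (n + 1) (fun s hs => by rw [coeff_E_of_lt hs, zero_mul]) (n + 1 + (j + 1)) (by omega),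
    ← hF (j + 1) (fun s hs => by rw [H_of_neg n (by omega), mul_zero]) (n + 1 + (j + 1))
      (by omega), ← h]
  refine Finset.sum_congr rfl fun s hs => ?_
  rw [Finset.mem_range] at hs
  rw [← Nat.cast_sub (by omega), H_nat]

/-- The minors along the first column do not involve `x`, so a linear recursion of the sequence
passes to the determinant. -/
theorem exponentDet_cons {n r : ℕ} (x : ℕ) (m : Fin r → ℕ) (a : ℤ → B A n) :
    exponentDet (Fin.cons x m : Fin (r + 1) → ℕ) a = ∑ i : Fin (r + 1),
      (-1) ^ (i : ℕ) * a ((x : ℤ) - (i.rev : ℕ)) *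
        Matrix.det (Matrix.of fun p q : Fin r => a ((m q : ℤ) - ((i.succAbove p).rev : ℕ))) := by
  rw [exponentDet, Matrix.det_succ_column_zero]
  rfl

theorem sum_coeff_E_mul_exponentDet {r x : ℕ} (m : Fin r → ℕ) (hx : r < x) :
    ∑ s ∈ Finset.range (r + 1 + 1), PowerSeries.coeff s (E A (r + 1)) *
      exponentDet (Fin.cons (x - s) m : Fin (r + 1) → ℕ) (H A (r + 1)) = 0 := by
  simp only [exponentDet_cons, Finset.mul_sum]
  rw [Finset.sum_comm]
  refine Finset.sum_eq_zero fun i _ => ?_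
  -- As `i.rev ≤ r < x`, every index in the first column is positive, where the recursion holds.
  have h := sum_coeff_E_mul_H (A := A) (r + 1) (j := (x : ℤ) - (i.rev : ℕ)) (by omega)
  have h' := congrArg (fun p => (-1) ^ (i : ℕ) * p * Matrix.det (Matrix.of fun p q : Fin r =>
    H A (r + 1) ((m q : ℤ) - ((i.succAbove p).rev : ℕ)))) h
  simp only [mul_zero, zero_mul, Finset.mul_sum, Finset.sum_mul] at h'
  rw [← h']
  refine Finset.sum_congr rfl fun s hs => ?_
  rw [Finset.mem_range] at hs
  have e : ((x - s : ℕ) : ℤ) - (i.rev : ℕ) = (x : ℤ) - (i.rev : ℕ) - s := by omega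
  rw [e]
  ring

/-- The matrix is $(h_{i-j})$, lower unitriangular. -/
theorem exponentDet_rev (r : ℕ) :
    exponentDet (fun j : Fin r => (j.rev : ℕ)) (H A r) = 1 := by
  rw [exponentDet, Matrix.det_of_isLowerTriangular]
  · refine Finset.prod_eq_one fun i _ => ?_
    rw [Matrix.of_apply, sub_self, H_zero]
  · intro i j hij
    have hij' : (i : ℕ) < j := hij
    rw [Matrix.of_apply, H_of_neg]
    simp only [Fin.val_rev]
    omega

variable [Algebra ℚ A]

/-- The wedge counterpart of `sum_coeff_E_mul_exponentDet`. With $u_s$ the coefficients of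
$\overline\sigma_+(z)u$, the terms are $b_{x-s}\wedge u_s-b_{x-s+1}\wedge u_{s-1}$; the sum
telescopes to $b_{x-r-1}\wedge u_{r+1}$, which vanishes by degree. -/
theorem sum_coeff_barPlusHS_ι_mul {r x : ℕ} {u : Ext A} (hu : u ∈ ⋀[A]^r (V A)) (hx : r < x) :
    ∑ s ∈ Finset.range (r + 1 + 1),
      (barPlusHS A (ι A (b A (x - s)) * u)).coeff s = 0 := by
  have key : ∀ N, N ≤ x → ∑ s ∈ Finset.range (N + 1),
      (barPlusHS A (ι A (b A (x - s)) * u)).coeff s =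
        ι A (b A (x - N)) * (barPlusHS A u).coeff N := by
    intro N
    induction N with
    | zero => intro _; simp [coeff_zero_barPlusHS]
    | succ N ih =>
      intro hN
      rw [Finset.sum_range_succ, ih (by omega), coeff_barPlusHS_b_mul,
        show x - (N + 1) + 1 = x - N by omega]
      abel
  rw [key (r + 1) hx, coeff_barPlusHS_eq_zero hu (by omega), mul_zero]

/-- Both sides change by the sign of the permutation. Allowing unsorted exponents lets any one of
them be brought to the front. -/
theorem ιMulti_eq_act_iff_comp_perm {r : ℕ} (m : Fin r → ℕ) (σ : Equiv.Perm (Fin r)) :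
    (ιMulti A r (fun j => b A ((m ∘ σ) j)) =
        act A r (exponentDet (m ∘ σ) (H A r)) (bWedge A r fun _ => 0)) ↔
      ιMulti A r (fun j => b A (m j)) =
        act A r (exponentDet m (H A r)) (bWedge A r fun _ => 0) := by
  have h : ιMulti A r (fun j => b A ((m ∘ σ) j)) =
      Equiv.Perm.sign σ • ιMulti A r (fun j => b A (m j)) :=
    (ιMulti A r).map_perm (fun j => b A (m j)) σ
  rw [h, exponentDet_comp_perm]
  rcases Int.units_eq_one_or (Equiv.Perm.sign σ) with e | e <;> rw [e] <;> simp

/-- The wedge product of basis vectors is a determinant in the `h_j` applied to `[b]^r_0`. -/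
theorem ιMulti_eq_act_exponentDet {r : ℕ} (m : Fin r → ℕ) :
    ιMulti A r (fun j => b A (m j)) =
      act A r (exponentDet m (H A r)) (bWedge A r fun _ => 0) := by
  induction hN : ∑ j, m j using Nat.strong_induction_on generalizing m with
  | _ N ih =>
  subst hN
  by_cases hm : ∀ j, m j < r
  · by_cases hinj : Function.Injective m
    -- Distinct exponents below $r$ are a permutation of $r-1,\dots,0$, where the determinant is 1.
    · let σ : Fin r → Fin r := fun j => Fin.rev ⟨m j, hm j⟩
      have hσ : Function.Bijective σ := by
        rw [← Finite.injective_iff_bijective]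
        intro i j hij
        exact hinj (Fin.ext_iff.1 (Fin.rev_injective hij))
      have e : m = (fun j : Fin r => (j.rev : ℕ)) ∘ Equiv.ofBijective σ hσ := by
        funext j
        simp only [σ, Function.comp_apply, Equiv.ofBijective_apply, Fin.rev_rev]
      rw [e, ιMulti_eq_act_iff_comp_perm, exponentDet_rev, map_one, Module.End.one_apply, bWedge]
      simp [expo]
    · simp only [Function.Injective, not_forall] at hinj
      obtain ⟨i, j, hij, hne⟩ := hinj
      rw [ιMulti A r |>.map_eq_zero_of_eq _ (by rw [hij]) hne, exponentDet,
        Matrix.det_zero_of_column_eq hne, map_zero, LinearMap.zero_apply]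
      intro k
      simp [hij]
  · push Not at hm
    obtain ⟨t, ht⟩ := hm
    obtain ⟨r, rfl⟩ : ∃ r', r = r' + 1 := ⟨r - 1, by have := t.2; omega⟩
    -- An exponent that is at least the number of factors goes to the front, where both recursions
    -- apply.
    rw [← ιMulti_eq_act_iff_comp_perm m (Equiv.swap 0 t)]
    have hsum : ∑ j, (m ∘ Equiv.swap 0 t) j = ∑ j, m j := Equiv.sum_comp _ m
    have h0 : r < (m ∘ Equiv.swap 0 t) 0 := by
      rw [Function.comp_apply, Equiv.swap_apply_left]
      omega
    rw [← hsum] at ih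
    generalize m ∘ Equiv.swap 0 t = m at ih h0 ⊢
    obtain ⟨x, m, rfl⟩ : ∃ x m', m = Fin.cons x m' := ⟨m 0, Fin.tail m, (Fin.cons_self_tail m).symm⟩
    rw [Fin.cons_zero] at h0
    set u := ιMulti A r (fun j => b A (m j)) with hu
    have hu' : u ∈ ⋀[A]^r (V A) := ExteriorAlgebra.ιMulti_range A r ⟨_, rfl⟩
    have hcons : ∀ y, ιMulti A (r + 1) (fun j => b A ((Fin.cons y m : Fin (r + 1) → ℕ) j)) =
        ι A (b A y) * u := by
      intro y
      rw [ExteriorAlgebra.ιMulti_succ_apply]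
      rfl
    have h1 := sum_coeff_barPlusHS_ι_mul hu' h0
    have h2 := congrArg (fun p => act A (r + 1) p (bWedge A (r + 1) fun _ => 0))
      (sum_coeff_E_mul_exponentDet (A := A) m h0)
    simp only [map_sum, map_mul, LinearMap.sum_apply, Module.End.mul_apply, map_zero,
      LinearMap.zero_apply] at h2
    rw [Finset.sum_range_succ'] at h1 h2
    rw [coeff_zero_E, map_one, Module.End.one_apply] at h2
    rw [coeff_zero_barPlusHS] at h1
    rw [Nat.sub_zero] at h1 h2
    -- Both recursions are solved for their $s=0$ term. The others have a smaller exponent sum, and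
    -- their coefficients agree because $E_{r+1}(z)$ acts as $\overline\sigma_+(z)$ in degree $r+1$.
    rw [hcons, eq_neg_of_add_eq_zero_right h1, eq_neg_of_add_eq_zero_right h2]
    congr 1
    refine Finset.sum_congr rfl fun s hs => ?_
    rw [Finset.mem_range] at hs
    rw [← ih _ ?_ _ rfl, hcons, act_coeff_E (ι_mul_mem_exteriorPower _ hu')]
    rw [Fin.sum_univ_succ, Fin.sum_univ_succ]
    simp only [Fin.cons_zero, Fin.cons_succ]
    omega

/-- Giambelli's formula. -/
theorem bWedge_eq_act_schurDet (r : ℕ) (l : Fin r → ℕ) :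
    bWedge A r l = act A r (schurDet A l (H A r)) (bWedge A r fun _ => 0) := by
  rw [← exponentDet_expo, ← ιMulti_eq_act_exponentDet]
  rfl

end Giambelli

end VertexOp

namespace VertexOp

open CliffordAlgebra (contractLeft contractLeft_ι_mul)
open ExteriorAlgebra (ι ιMulti)

/-! ### Contraction with $b_j\mapsto c^j$ against $\overline\sigma_+$ -/

section Contraction

variable {A : Type} [CommRing A]

/-- The functional `b_j ↦ c^j` on `V`. -/
noncomputable def powFunctional (c : A) : Module.Dual A (V A) :=
  Finsupp.linearCombination A fun j => c ^ j

theorem powFunctional_b (c : A) (j : ℕ) : powFunctional c (b A j) = c ^ j := by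
  simp [powFunctional, b, Finsupp.linearCombination_single]

/-- The functional is an eigenvector of the transpose of $\sigma_1$; this is the source of every
factor $1-cz$ below. -/
theorem powFunctional_shift (c : A) (v : V A) :
    powFunctional c (shift A v) = c * powFunctional c v := by
  have h : powFunctional c ∘ₗ shift A = c • powFunctional c := by
    refine Finsupp.lhom_ext fun j a => ?_
    have e : Finsupp.single j a = a • b A j := by simp [b]
    rw [e, map_smul, map_smul, LinearMap.comp_apply, shift_b, powFunctional_b,
      LinearMap.smul_apply, powFunctional_b, pow_succ', smul_eq_mul c]
  exact LinearMap.congr_fun h v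

/-- Successive left contractions with `f_1, ..., f_k`. -/
noncomputable def contractAll : (k : ℕ) → (Fin k → Module.Dual A (V A)) → Module.End A (Ext A)
  | 0, _ => LinearMap.id
  | k + 1, f => contractAll k (Fin.tail f) ∘ₗ contractLeft (f 0)

theorem contractAll_succ_apply {k : ℕ} (f : Fin (k + 1) → Module.Dual A (V A)) (u : Ext A) :
    contractAll (k + 1) f u = contractAll k (Fin.tail f) (contractLeft (f 0) u) := rfl

variable [Algebra ℚ A]

/-- Coefficient form of $f\lrcorner\,\overline\sigma_+(z)u=(1-cz)\,\overline\sigma_+(z)(f\lrcorner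
u)$, which follows from the antiderivation rule and $f(v-z\sigma_1v)=(1-cz)f(v)$. -/
theorem contractLeft_coeff_barPlusHS (c : A) (i : ℕ) (u : Ext A) :
    contractLeft (powFunctional c) ((barPlusHS A u).coeff (i + 1)) =
      (barPlusHS A (contractLeft (powFunctional c) u)).coeff (i + 1) -
        c • (barPlusHS A (contractLeft (powFunctional c) u)).coeff i := by
  induction u using CliffordAlgebra.left_induction generalizing i with
  | algebraMap a =>
    have h : (barPlusHS A (algebraMap A (Ext A) a)).coeff (i + 1) = 0 := by
      rw [AlgHom.commutes, Polynomial.algebraMap_apply, Polynomial.coeff_C_succ]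
    rw [CliffordAlgebra.contractLeft_algebraMap, map_zero, h, map_zero]
    simp
  | add x y hx hy =>
    simp only [map_add, Polynomial.coeff_add, hx, hy, smul_add]
    abel
  | ι_mul u v ih =>
    set f := powFunctional c
    have hu : contractLeft f (ι A v * u) = f v • u - ι A v * contractLeft f u :=
      contractLeft_ι_mul _ _ _
    have hc : contractLeft f ((barPlusHS A (ι A v * u)).coeff (i + 1)) =
        f v • (barPlusHS A u).coeff (i + 1) -
          ι A v * contractLeft f ((barPlusHS A u).coeff (i + 1)) -
        ((c * f v) • (barPlusHS A u).coeff i -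
          ι A (shift A v) * contractLeft f ((barPlusHS A u).coeff i)) := by
      rw [coeff_succ_barPlusHS_ι_mul, map_sub, ← powFunctional_shift]
      exact congrArg₂ _ (contractLeft_ι_mul _ _ _) (contractLeft_ι_mul _ _ _)
    show contractLeft f ((barPlusHS A (ι A v * u)).coeff (i + 1)) =
      (barPlusHS A (contractLeft f (ι A v * u))).coeff (i + 1) -
        c • (barPlusHS A (contractLeft f (ι A v * u))).coeff i
    rw [hc, hu, map_sub, map_smul, Polynomial.coeff_sub, Polynomial.coeff_sub,
      Polynomial.coeff_smul, Polynomial.coeff_smul, coeff_succ_barPlusHS_ι_mul, ih]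
    rcases i with _ | i
    · simp only [coeff_zero_barPlusHS, mul_sub, smul_sub, mul_smul_comm, mul_smul]
      abel
    · rw [coeff_succ_barPlusHS_ι_mul, ih]
      simp only [mul_sub, smul_sub, mul_smul_comm, mul_smul]
      abel

theorem contractLeft_barPlus (c w : A) (u : Ext A) :
    contractLeft (powFunctional c) (barPlus A w u) =
      (1 - w * c) • barPlus A w (contractLeft (powFunctional c) u) := by
  induction u using CliffordAlgebra.left_induction with
  | algebraMap a =>
    rw [CliffordAlgebra.contractLeft_algebraMap, map_zero, AlgHom.commutes, smul_zero]
    exact CliffordAlgebra.contractLeft_algebraMap _ _ _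
  | add x y hx hy => simp only [map_add, hx, hy, smul_add]
  | ι_mul u v ih =>
    set f := powFunctional c
    have h1 : barPlus A w (ι A v * u) = ι A (v - w • shift A v) * barPlus A w u := by
      rw [map_mul, barPlus_ι, map_sub, map_smul]
    have h2 : f (v - w • shift A v) = (1 - w * c) * f v := by
      rw [map_sub, map_smul, powFunctional_shift, smul_eq_mul]
      ring
    have h3 : contractLeft f (barPlus A w (ι A v * u)) = f (v - w • shift A v) • barPlus A w u -
        ι A (v - w • shift A v) * contractLeft f (barPlus A w u) := by
      rw [h1]
      exact contractLeft_ι_mul _ _ _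
    have h4 : barPlus A w (contractLeft f (ι A v * u)) = f v • barPlus A w u -
        ι A (v - w • shift A v) * barPlus A w (contractLeft f u) := by
      have h5 : contractLeft f (ι A v * u) = f v • u - ι A v * contractLeft f u :=
        contractLeft_ι_mul _ _ _
      rw [h5, map_sub, map_smul, map_mul, barPlus_ι, map_sub, map_smul]
    refine h3.trans (Eq.trans ?_ (congrArg _ h4.symm))
    rw [ih, h2, mul_smul_comm, smul_sub, mul_smul]

/-- All terms of positive degree in $w$ contain $b_m$, hence are killed by it. -/
theorem ι_mul_barPlus_bWedge_zero (w : A) (m : ℕ) :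
    ι A (b A m) * barPlus A w (bWedge A m fun _ => 0) = ι A (b A m) * bWedge A m fun _ => 0 := by
  rw [barPlus_eq_sum_range (N := m + 1) w fun i hi => coeff_barPlusHS_bWedge_zero A m i hi,
    Finset.sum_range_succ', mul_add, coeff_zero_barPlusHS, pow_zero, one_smul, Finset.mul_sum,
    Finset.sum_eq_zero, zero_add]
  intro i _
  rw [mul_smul_comm, ι_mul_coeff_barPlusHS, smul_zero]

theorem contractLeft_bWedge_zero {c w : A} (h : w * c = 1) (m : ℕ) :
    w ^ m • contractLeft (powFunctional c) (bWedge A (m + 1) fun _ => 0) =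
      barPlus A w (bWedge A m fun _ => 0) := by
  have hc : ∀ m (u : Ext A), contractLeft (powFunctional c) (ι A (b A m) * u) =
      c ^ m • u - ι A (b A m) * contractLeft (powFunctional c) u := by
    intro m u
    rw [← powFunctional_b]
    exact contractLeft_ι_mul _ _ _
  induction m with
  | zero =>
    have h0 : bWedge A 0 (fun _ => 0) = algebraMap A (Ext A) 1 := by
      rw [bWedge, ExteriorAlgebra.ιMulti_zero_apply, map_one]
    rw [bWedge_zero_succ, hc, h0, AlgHom.commutes, CliffordAlgebra.contractLeft_algebraMap]
    simp
  | succ m ih =>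
    -- Both sides become $b_m\wedge[\mathbf b]^m_0-w\,b_{m+1}\wedge\overline\sigma_+(w)[\mathbf
    -- b]^m_0$: on the left by the induction hypothesis, on the right because $b_m$ absorbs
    -- $\overline\sigma_+(w)$.
    rw [bWedge_zero_succ A (m + 1), hc, smul_sub, smul_smul, ← mul_pow, h, one_pow, one_smul,
      ← mul_smul_comm, pow_succ', mul_smul, ih, mul_smul_comm, bWedge_zero_succ A m, map_mul,
      barPlus_ι, shift_b, sub_mul, ι_mul_barPlus_bWedge_zero, smul_mul_assoc]

end Contraction

/-! ### Contraction as a change of rings $B_{n+1}\to B_n$ -/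

section Specialization

variable {A : Type} [CommRing A]

/-- The homomorphism `B_{n+1} → B_n` that sends `E_{n+1}(z)` to `(1 - c z) E_n(z)`. -/
noncomputable def adjoinRoot (n : ℕ) (c : A) : B A (n + 1) →ₐ[A] B A n :=
  MvPolynomial.aeval fun i : Fin (n + 1) => (-1 : A) ^ ((i : ℕ) + 1) •
    (PowerSeries.coeff ((i : ℕ) + 1) (E A n) - c • PowerSeries.coeff (i : ℕ) (E A n))

theorem adjoinRoot_coeff_succ_E (n : ℕ) (c : A) (i : ℕ) :
    adjoinRoot n c (PowerSeries.coeff (i + 1) (E A (n + 1))) =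
      PowerSeries.coeff (i + 1) (E A n) - c • PowerSeries.coeff i (E A n) := by
  by_cases h : i < n + 1
  · have e : (-1 : B A (n + 1)) ^ (i + 1) * MvPolynomial.X (⟨i, h⟩ : Fin (n + 1)) =
        (-1 : A) ^ (i + 1) • MvPolynomial.X (⟨i, h⟩ : Fin (n + 1)) := by
      rw [Algebra.smul_def, map_pow, map_neg, map_one]
    rw [coeff_succ_E h, e, map_smul, adjoinRoot, MvPolynomial.aeval_X, smul_smul, ← mul_pow]
    simp
  · rw [coeff_E_of_lt (by omega), coeff_E_of_lt (by omega), coeff_E_of_lt (by omega), map_zero,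
      smul_zero, sub_zero]

theorem map_adjoinRoot_E (n : ℕ) (c : A) :
    PowerSeries.map (adjoinRoot n c : B A (n + 1) →+* B A n) (E A (n + 1)) =
      (1 - PowerSeries.C (MvPolynomial.C c) * PowerSeries.X) * E A n := by
  ext1 i
  rw [PowerSeries.coeff_map, sub_mul, one_mul, mul_assoc, map_sub, PowerSeries.coeff_C_mul]
  rcases i with _ | i
  · rw [coeff_zero_E, coeff_zero_E, PowerSeries.coeff_zero_X_mul, map_one, mul_zero, sub_zero]
  · rw [PowerSeries.coeff_succ_X_mul, ← MvPolynomial.smul_eq_C_mul]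
    exact adjoinRoot_coeff_succ_E n c i

theorem minusSeq_of_neg (n : ℕ) (c : A) {a : ℤ → B A n} (ha : ∀ j < 0, a j = 0) {j : ℤ}
    (hj : j < 0) : minusSeq A n c a j = 0 :=
  Finset.sum_eq_zero fun i _ => by rw [ha _ (by omega), smul_zero]

/-- In terms of generating series, $\sigma_-(w)$ divides by $1-cz$; this is the recursion expressing
it. -/
theorem minusSeq_succ (n : ℕ) (c : A) (a : ℤ → B A n) (j : ℕ) :
    minusSeq A n c a ((j + 1 : ℕ) : ℤ) = a ((j + 1 : ℕ) : ℤ) + c • minusSeq A n c a j := by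
  rw [minusSeq, minusSeq, Int.toNat_natCast, Int.toNat_natCast, Finset.sum_range_succ', add_comm,
    Finset.smul_sum]
  congr 1
  · simp
  · refine Finset.sum_congr rfl fun i _ => ?_
    rw [smul_smul, ← pow_succ']
    congr 2
    omega

/-- The image of $1/E_{n+1}(z)$ and the series of $\sigma_-(w)H_n$ are both inverse to
$(1-cz)E_n(z)$. -/
theorem adjoinRoot_H (n : ℕ) (c : A) (j : ℤ) :
    adjoinRoot n c (H A (n + 1) j) = minusSeq A n c (H A n) j := by
  rcases lt_or_ge j 0 with hj | hj
  · rw [H_of_neg _ hj, map_zero, minusSeq_of_neg n c (fun _ => H_of_neg n) hj]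
  obtain ⟨j, rfl⟩ := Int.eq_ofNat_of_zero_le hj
  set K : PowerSeries (B A n) := PowerSeries.mk fun i => minusSeq A n c (H A n) i with hK
  have h1 : (1 - PowerSeries.C (MvPolynomial.C c) * PowerSeries.X) * K =
      PowerSeries.invOfUnit (E A n) 1 := by
    ext1 i
    rw [sub_mul, one_mul, mul_assoc, map_sub, PowerSeries.coeff_C_mul, ← H_nat]
    rcases i with _ | i
    · rw [PowerSeries.coeff_zero_X_mul, mul_zero, sub_zero, hK, PowerSeries.coeff_mk]
      simp [minusSeq]
    · rw [PowerSeries.coeff_succ_X_mul, ← MvPolynomial.smul_eq_C_mul, hK, PowerSeries.coeff_mk,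
        PowerSeries.coeff_mk, minusSeq_succ, add_sub_cancel_right]
  have h2 := congrArg (PowerSeries.map (adjoinRoot n c : B A (n + 1) →+* B A n))
    (E_mul_H A (n + 1))
  rw [map_mul, map_one, map_adjoinRoot_E, mul_comm] at h2
  have h3 : (1 - PowerSeries.C (MvPolynomial.C c) * PowerSeries.X) * E A n * K = 1 := by
    rw [mul_right_comm, h1, mul_comm, E_mul_H]
  have h4 := congrArg (PowerSeries.coeff j) (left_inv_eq_right_inv h2 h3)
  rw [PowerSeries.coeff_map, ← H_nat, hK, PowerSeries.coeff_mk] at h4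
  exact h4

theorem map_minusSeq {n m : ℕ} (φ : B A n →ₐ[A] B A m) (c : A) (a : ℤ → B A n) (j : ℤ) :
    φ (minusSeq A n c a j) = minusSeq A m c (fun i => φ (a i)) j := by
  simp only [minusSeq, map_sum, map_smul]

theorem map_schurDet {n m r : ℕ} (φ : B A n →ₐ[A] B A m) (l : Fin r → ℕ) (a : ℤ → B A n) :
    φ (schurDet A l a) = schurDet A l fun i => φ (a i) := by
  rw [schurDet, AlgHom.map_det]
  rfl

variable [Algebra ℚ A]

/-- It suffices to treat the generators, where this is `contractLeft_coeff_barPlusHS`. The degree of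
`u` matters: only on $\bigwedge^nV$ do all coefficients of $\overline\sigma_+(z)$ come from
$E_n(z)$. -/
theorem contractLeft_act {n : ℕ} (c : A) (p : B A (n + 1)) {u : Ext A}
    (hu : u ∈ ⋀[A]^(n + 1) (V A)) :
    contractLeft (powFunctional c) (act A (n + 1) p u) =
      act A n (adjoinRoot n c p) (contractLeft (powFunctional c) u) := by
  induction p using MvPolynomial.induction_on generalizing u with
  | C a =>
    rw [act_C_apply, map_smul, ← MvPolynomial.algebraMap_eq, AlgHom.commutes, AlgHom.commutes,
      Module.algebraMap_end_apply]
  | add p q hp hq => simp only [map_add, LinearMap.add_apply, hp hu, hq hu]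
  | mul_X p i hp =>
    have hX : contractLeft (powFunctional c) (act A (n + 1) (MvPolynomial.X i) u) =
        act A n (adjoinRoot n c (MvPolynomial.X i)) (contractLeft (powFunctional c) u) := by
      rw [act_X_apply, map_smul, contractLeft_coeff_barPlusHS, adjoinRoot, MvPolynomial.aeval_X,
        map_smul, map_sub, map_smul, LinearMap.smul_apply, LinearMap.sub_apply,
        LinearMap.smul_apply, act_coeff_E (contractLeft_mem_exteriorPower _ hu),
        act_coeff_E (contractLeft_mem_exteriorPower _ hu)]
    rw [map_mul, map_mul, map_mul, Module.End.mul_apply, Module.End.mul_apply,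
      hp (act_mem _ hu), hX]

theorem exists_contractAll_act (k n : ℕ) (c : Fin k → A) :
    ∃ φ : B A (n + k) →ₐ[A] B A n,
      (∀ (p : B A (n + k)) (u : Ext A), u ∈ ⋀[A]^(n + k) (V A) →
        contractAll k (fun i => powFunctional (c i)) (act A (n + k) p u) =
          act A n (φ p) (contractAll k (fun i => powFunctional (c i)) u)) ∧
      ∀ j, φ (H A (n + k) j) =
        (List.ofFn fun i => minusSeq A n (c i)).foldr (fun T a => T a) (H A n) j := by
  induction k with
  | zero => exact ⟨AlgHom.id A _, fun _ _ _ => rfl, fun _ => rfl⟩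
  | succ k ih =>
    obtain ⟨φ, h1, h2⟩ := ih (Fin.tail c)
    -- The contraction with parameter `c 0` comes first, so its specialization is innermost; its
    -- $\sigma_-$ still ends up outermost, since `φ` commutes with `minusSeq`.
    refine ⟨φ.comp (adjoinRoot (n + k) (c 0)), fun p u hu => ?_, fun j => ?_⟩
    · rw [contractAll_succ_apply, contractAll_succ_apply]
      refine (congrArg _ (contractLeft_act (n := n + k) (c 0) p hu)).trans ?_
      exact h1 _ _ (contractLeft_mem_exteriorPower _ hu)
    · rw [AlgHom.comp_apply]
      refine (congrArg φ (adjoinRoot_H (n + k) (c 0) j)).trans ?_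
      rw [map_minusSeq, funext h2, List.ofFn_succ, List.foldr_cons]
      rfl

theorem contractAll_barPlus (k : ℕ) (c : Fin k → A) (w : A) (u : Ext A) :
    contractAll k (fun i => powFunctional (c i)) (barPlus A w u) =
      (∏ i, (1 - w * c i)) •
        barPlus A w (contractAll k (fun i => powFunctional (c i)) u) := by
  induction k generalizing u with
  | zero => simp [contractAll]
  | succ k ih =>
    rw [contractAll_succ_apply, contractAll_succ_apply, contractLeft_barPlus, map_smul,
      Fin.prod_univ_succ, mul_smul]
    exact congrArg _ (ih (Fin.tail c) _)

/-- The first contraction produces $\overline\sigma_+(w_0)$; each remaining one passes it at the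
cost $1-w_0c_i$, and $w_i(1-w_0c_i)=w_i-w_0$ uses up one power of $w_i$ and gives a Vandermonde
factor. -/
theorem contractAll_bWedge_zero (k n : ℕ) (c w : Fin k → A) (h : ∀ i, w i * c i = 1) :
    (∏ i, w i ^ (n + k - 1)) •
        contractAll k (fun i => powFunctional (c i)) (bWedge A (n + k) fun _ => 0) =
      (∏ i, ∏ j ∈ Finset.Ioi i, (w j - w i)) •
        (List.ofFn fun i => barPlus A (w i)).prod (bWedge A n fun _ => 0) := by
  induction k with
  | zero => simp [contractAll]
  | succ k ih =>
    have ih' := ih (Fin.tail c) (Fin.tail w) fun i => h _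
    have e : (∏ i : Fin k, w i.succ ^ (n + k)) * ∏ i : Fin k, (1 - w 0 * c i.succ) =
        (∏ i : Fin k, (w i.succ - w 0)) * ∏ i : Fin k, w i.succ ^ (n + k - 1) := by
      rw [← Finset.prod_mul_distrib, ← Finset.prod_mul_distrib]
      refine Finset.prod_congr rfl fun i _ => ?_
      have hk : n + k = n + k - 1 + 1 := by have := i.2; omega
      rw [hk, Nat.add_sub_cancel, pow_succ]
      linear_combination (- w i.succ ^ (n + k - 1) * w 0) * h i.succ
    have h1 : w 0 ^ (n + k) • contractAll (k + 1) (fun i => powFunctional (c i))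
          (bWedge A (n + (k + 1)) fun _ => 0) = (∏ i : Fin k, (1 - w 0 * c i.succ)) •
        barPlus A (w 0) (contractAll k (fun i => powFunctional (Fin.tail c i))
          (bWedge A (n + k) fun _ => 0)) := by
      rw [contractAll_succ_apply, ← map_smul]
      refine (congrArg _ (contractLeft_bWedge_zero (h 0) (n + k))).trans ?_
      exact contractAll_barPlus k (Fin.tail c) (w 0) _
    rw [show n + (k + 1) - 1 = n + k by omega, Fin.prod_univ_succ, mul_comm, mul_smul, h1,
      smul_smul, e, mul_smul, ← map_smul]
    refine (congrArg (fun x => _ • barPlus A (w 0) x) ih').trans ?_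
    rw [map_smul, smul_smul, Fin.prod_univ_succ, List.ofFn_succ, List.prod_cons,
      AlgHom.mul_apply]
    congr 2
    · rw [Fin.Ioi_zero_eq_map, Finset.prod_map]
      rfl
    · refine Finset.prod_congr rfl fun i _ => ?_
      rw [Fin.Ioi_succ, Finset.prod_map]
      rfl

end Specialization

end VertexOp

namespace VertexOp

open CliffordAlgebra (contractLeft contractLeft_ι_mul)
open ExteriorAlgebra (ι ιMulti)

/-! ### The bordered determinant as an iterated contraction -/

section Laplace

variable {A : Type} [CommRing A]

/-- Either `v` survives all $k+1$ contractions, each giving a sign, or it is absorbed by exactly one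
`f i`, after passing the `i` earlier ones. -/
theorem contractAll_ι_mul (k : ℕ) (f : Fin (k + 1) → Module.Dual A (V A)) (v : V A)
    (u : Ext A) : contractAll (k + 1) f (ι A v * u) =
      (-1 : A) ^ (k + 1) • (ι A v * contractAll (k + 1) f u) +
        ∑ i : Fin (k + 1), ((-1) ^ (i : ℕ) * f i v) •
          contractAll k (fun j => f (i.succAbove j)) u := by
  have h : contractLeft (f 0) (ι A v * u) = f 0 v • u - ι A v * contractLeft (f 0) u :=
    contractLeft_ι_mul _ _ _
  induction k generalizing u with
  | zero =>
    rw [contractAll_succ_apply, contractAll_succ_apply, h]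
    simp [contractAll]
    abel
  | succ k ih =>
    have ih' := ih (Fin.tail f) (contractLeft (f 0) u) (contractLeft_ι_mul _ _ _)
    rw [contractAll_succ_apply, h, map_sub, map_smul, ih', Fin.sum_univ_succ (n := k + 1),
      contractAll_succ_apply f u, pow_succ (-1 : A) (k + 1)]
    have e : ∀ i : Fin (k + 1), contractAll (k + 1) (fun j => f (i.succ.succAbove j)) u =
        contractAll k (fun j => Fin.tail f (i.succAbove j)) (contractLeft (f 0) u) := by
      intro i
      rw [contractAll_succ_apply, Fin.succ_succAbove_zero]
      congr 2
      funext j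
      simp [Fin.tail, Fin.succ_succAbove_succ]
    simp only [e, Fin.val_zero, pow_zero, one_mul, Fin.val_succ, pow_succ _ (_ : ℕ), mul_neg,
      mul_one, neg_mul, neg_smul, Finset.sum_neg_distrib, Fin.zero_succAbove]
    simp only [Fin.tail]
    rw [show (fun j => f j.succ) = Fin.tail f from rfl]
    abel

theorem sort_eq_filter_finRange {r : ℕ} (T : Finset (Fin r)) :
    T.sort = (List.finRange r).filter (· ∈ T) := by
  have hn : ((List.finRange r).filter (· ∈ T)).Nodup := (List.nodup_finRange r).filter _
  have h := (List.toFinset_sort (· ≤ ·) hn).2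
    (((List.sortedLT_finRange r).pairwise.imp le_of_lt).filter _)
  rw [← h]
  congr 1
  ext j
  simp

/-- Padding with 1 off `T` gives a product over all of `Fin r`, from which the factor of column 0
splits off without tracking cardinalities. -/
theorem prod_ofFn_orderEmbOfFin {M : Type*} [Monoid M] {r n : ℕ} (T : Finset (Fin r))
    (h : T.card = n) (g : Fin r → M) :
    (List.ofFn fun j => g (T.orderEmbOfFin h j)).prod =
      (List.ofFn fun j => if j ∈ T then g j else 1).prod := by
  have e : (List.ofFn fun j => g (T.orderEmbOfFin h j)) = T.sort.map g := by
    rw [← Finset.listMap_orderEmbOfFin_finRange T h, List.map_map, List.ofFn_eq_map]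
    rfl
  rw [e, sort_eq_filter_finRange, List.ofFn_eq_map]
  induction List.finRange r with
  | nil => rfl
  | cons a l ih =>
    by_cases ha : a ∈ T <;> simp [ha, ih]

/-- The term of the Laplace expansion of a bordered determinant at the set `S` of columns. -/
noncomputable def laplaceTerm {k r : ℕ} (M : Matrix (Fin k) (Fin r) A) (v : Fin r → V A)
    (S : Finset (Fin r)) : Ext A :=
  if h : S.card = k then
    ((-1) ^ (∑ i : Fin k, (i : ℕ) + ∑ j ∈ S, (j : ℕ)) *
        (M.submatrix id (S.orderEmbOfFin h)).det) •
      (List.ofFn fun j => if j ∈ S then 1 else ι A (v j)).prod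
  else 0

/-- Summing over all subsets, with zero for the wrong size, permits induction on `r` by whether a
subset contains column 0. -/
theorem borderedDet_eq_sum_laplaceTerm {k r : ℕ} (M : Matrix (Fin k) (Fin r) A)
    (v : Fin r → V A) : borderedDet M v = ∑ S, laplaceTerm M v S := by
  have h0 : ∑ S, laplaceTerm M v S =
      ∑ S ∈ Finset.univ.filter (fun S : Finset (Fin r) => S.card = k), laplaceTerm M v S := by
    rw [Finset.sum_filter]
    refine Finset.sum_congr rfl fun S _ => ?_
    rw [laplaceTerm]
    split_ifs <;> rfl
  rw [h0, borderedDet, Finset.sum_subtype (p := fun S => S ∈ Set.powersetCard (Fin r) k)]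
  · refine Finset.sum_congr rfl fun S _ => ?_
    rw [laplaceTerm, dif_pos (Set.powersetCard.card_eq S), ExteriorAlgebra.ιMulti_apply,
      prod_ofFn_orderEmbOfFin (g := fun j => ι A (v j))]
    simp only [Finset.mem_compl, ite_not]
  · intro S
    simp [Set.powersetCard.mem_iff]

theorem sum_finset_fin_succ {M : Type*} [AddCommMonoid M] {r : ℕ}
    (F : Finset (Fin (r + 1)) → M) :
    ∑ S, F S = ∑ T : Finset (Fin r), F (T.map (Fin.succEmb r)) +
      ∑ T : Finset (Fin r), F (insert 0 (T.map (Fin.succEmb r))) := by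
  rw [← Finset.sum_filter_not_add_sum_filter Finset.univ (fun S : Finset (Fin (r + 1)) => 0 ∈ S)]
  congr 1
  · refine Finset.sum_nbij' (fun S => S.preimage Fin.succ (Fin.succ_injective r).injOn)
      (fun T => T.map (Fin.succEmb r)) (by simp) (by simp) ?_ ?_ ?_
    · intro S hS
      ext j
      refine Fin.cases ?_ (fun j => ?_) j
      · simpa using hS
      · simp
    · intro T _
      ext j
      simp
    · intro S hS
      congr 1
      ext j
      refine Fin.cases ?_ (fun j => ?_) j
      · simpa using hS
      · simp
  · refine Finset.sum_nbij' (fun S => S.preimage Fin.succ (Fin.succ_injective r).injOn)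
      (fun T => insert 0 (T.map (Fin.succEmb r))) (by simp) (by simp) ?_ ?_ ?_
    · intro S hS
      ext j
      refine Fin.cases ?_ (fun j => ?_) j
      · simpa using hS
      · simp
    · intro T _
      ext j
      simp
    · intro S hS
      congr 1
      ext j
      refine Fin.cases ?_ (fun j => ?_) j
      · simpa using hS
      · simp

/-- Column 0 is not selected, so `v 0` leads the wedge product; shifting the $k$ selected column
indices by one gives the sign. -/
theorem laplaceTerm_map_succ {k r : ℕ} (M : Matrix (Fin k) (Fin (r + 1)) A)
    (v : Fin (r + 1) → V A) (T : Finset (Fin r)) :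
    laplaceTerm M v (T.map (Fin.succEmb r)) =
      (-1 : A) ^ k • (ι A (v 0) * laplaceTerm (M.submatrix id Fin.succ) (Fin.tail v) T) := by
  by_cases h : T.card = k
  · have h' : (T.map (Fin.succEmb r)).card = k := by rw [Finset.card_map, h]
    have e : (fun j => (T.orderEmbOfFin h j).succ) = (T.map (Fin.succEmb r)).orderEmbOfFin h' :=
      Finset.orderEmbOfFin_unique h' (fun j => by simp) fun i j hij => by simpa using hij
    rw [laplaceTerm, laplaceTerm, dif_pos h', dif_pos h, ← e, List.ofFn_succ, List.prod_cons,
      Matrix.submatrix_submatrix, Finset.sum_map, mul_smul_comm, smul_smul]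
    congr 1
    · rw [← mul_assoc, ← pow_add]
      congr 2
      simp [Finset.sum_add_distrib, h]
      ring
    · simp [Fin.tail]
  · rw [laplaceTerm, laplaceTerm, dif_neg h, dif_neg (by rwa [Finset.card_map]), mul_zero,
      smul_zero]

theorem card_insert_zero_map_succ {r : ℕ} (T : Finset (Fin r)) :
    (insert 0 (T.map (Fin.succEmb r))).card = T.card + 1 := by
  rw [Finset.card_insert_of_notMem (by simp), Finset.card_map]

/-- Expansion of the minor along column 0, which is its first column. -/
theorem laplaceTerm_insert_zero {k r : ℕ} (M : Matrix (Fin (k + 1)) (Fin (r + 1)) A)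
    (v : Fin (r + 1) → V A) (T : Finset (Fin r)) :
    laplaceTerm M v (insert 0 (T.map (Fin.succEmb r))) = ∑ i : Fin (k + 1),
      ((-1) ^ (i : ℕ) * M i 0) •
        laplaceTerm (M.submatrix i.succAbove Fin.succ) (Fin.tail v) T := by
  by_cases h : T.card = k
  · have h' : (insert 0 (T.map (Fin.succEmb r))).card = k + 1 := by
      rw [card_insert_zero_map_succ, h]
    have e : (Fin.cons 0 (fun j => (T.orderEmbOfFin h j).succ) : Fin (k + 1) → Fin (r + 1)) =
        (insert 0 (T.map (Fin.succEmb r))).orderEmbOfFin h' := by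
      refine Finset.orderEmbOfFin_unique h' (fun j => ?_) ?_
      · refine Fin.cases ?_ (fun j => ?_) j <;> simp
      · refine Fin.strictMono_iff_lt_succ.2 fun i => ?_
        rw [Fin.cons_succ]
        rcases k with _ | k
        · exact i.elim0
        refine Fin.cases ?_ (fun i => ?_) i
        · simp
        · rw [← Fin.succ_castSucc, Fin.cons_succ]
          exact Fin.succ_lt_succ_iff.2 ((T.orderEmbOfFin h).strictMono i.castSucc_lt_succ)
    simp only [laplaceTerm, dif_pos h', dif_pos h]
    rw [← e, List.ofFn_succ, List.prod_cons, Finset.sum_insert (by simp), Finset.sum_map,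
      Matrix.det_succ_column_zero, Finset.mul_sum, Finset.sum_smul]
    refine Finset.sum_congr rfl fun i _ => ?_
    rw [smul_smul]
    congr 1
    · have hs : (-1 : A) ^ (∑ i : Fin (k + 1), (i : ℕ) + (((0 : Fin (r + 1)) : ℕ) +
          ∑ j ∈ T, (Fin.succEmb r j : ℕ))) =
          (-1) ^ (∑ i : Fin k, (i : ℕ) + ∑ j ∈ T, (j : ℕ)) := by
        -- The additional row index contributes $k$, and so does the shift of the other $k$ columns;
        -- together they leave the sign unchanged.
        have : (∑ i : Fin (k + 1), (i : ℕ) + (((0 : Fin (r + 1)) : ℕ) +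
          ∑ j ∈ T, (Fin.succEmb r j : ℕ))) =
            (∑ i : Fin k, (i : ℕ) + ∑ j ∈ T, (j : ℕ)) + 2 * k := by
          rw [Fin.sum_univ_castSucc]
          simp [Finset.sum_add_distrib, h]
          ring
        rw [this, pow_add, pow_mul, neg_one_sq, one_pow, mul_one]
      rw [hs]
      have hd : ((M.submatrix id (Fin.cons 0 fun j => (T.orderEmbOfFin h j).succ)).submatrix
          i.succAbove Fin.succ) = (M.submatrix i.succAbove Fin.succ).submatrix id
            (T.orderEmbOfFin h) := rfl
      rw [hd, Matrix.submatrix_apply, Fin.cons_zero]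
      simp only [id]
      ring
    · simp [Fin.tail]
  · have h' : (insert 0 (T.map (Fin.succEmb r))).card ≠ k + 1 := by
      rw [card_insert_zero_map_succ]
      omega
    simp only [laplaceTerm, dif_neg h, dif_neg h', smul_zero, Finset.sum_const_zero]

/-- The Laplace expansion of a bordered determinant is an iterated contraction. -/
theorem contractAll_ιMulti (k r : ℕ) (f : Fin k → Module.Dual A (V A)) (v : Fin r → V A) :
    contractAll k f (ιMulti A r v) = borderedDet (Matrix.of fun i j => f i (v j)) v := by
  rw [borderedDet_eq_sum_laplaceTerm]
  induction r generalizing k with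
  | zero =>
    rw [Fintype.sum_subsingleton _ ∅, ExteriorAlgebra.ιMulti_zero_apply, laplaceTerm]
    rcases k with _ | k
    · simp [contractAll]
    · rw [dif_neg (by simp), contractAll_succ_apply]
      refine (congrArg _ (CliffordAlgebra.contractLeft_one (Q := 0) (f 0))).trans (map_zero _)
  | succ r ih =>
    have hv : ιMulti A (r + 1) v = ι A (v 0) * ιMulti A r (Fin.tail v) :=
      ExteriorAlgebra.ιMulti_succ_apply v
    rw [hv, sum_finset_fin_succ]
    simp only [laplaceTerm_map_succ, ← Finset.smul_sum, ← Finset.mul_sum]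
    rcases k with _ | k
    · rw [Finset.sum_eq_zero (s := Finset.univ)
        (f := fun T : Finset (Fin r) => laplaceTerm _ v (insert 0 (T.map (Fin.succEmb r)))),
        add_zero, pow_zero, one_smul]
      · exact congrArg (ι A (v 0) * ·) (ih 0 f (Fin.tail v))
      · intro T _
        rw [laplaceTerm, dif_neg]
        rw [card_insert_zero_map_succ]
        omega
    · simp only [laplaceTerm_insert_zero]
      -- Subsets without column 0 match the term where `v 0` survives; those with it match the terms
      -- where some `f i` absorbs `v 0`.
      rw [Finset.sum_comm, contractAll_ι_mul]
      simp only [← Finset.smul_sum]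
      congr 1
      · congr 2
        exact ih (k + 1) f (Fin.tail v)
      · refine Finset.sum_congr rfl fun i _ => congrArg _ ?_
        exact ih k (fun j => f (i.succAbove j)) (Fin.tail v)

end Laplace

end VertexOp

namespace VertexOp

/-! ### Assembly over the Laurent polynomials -/

section Vertex

theorem wPow_pow {k : ℕ} (i : Fin k) (m : ℤ) (n : ℕ) : wPow i m ^ n = wPow i (n * m) := by
  rw [wPow, wPow, AddMonoidAlgebra.single_pow, one_pow, ← Pi.single_smul', nsmul_eq_mul]

theorem wPow_mul_wPow_neg {k : ℕ} (i : Fin k) : wPow i 1 * wPow i (-1) = 1 := by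
  rw [wPow, wPow, AddMonoidAlgebra.single_mul_single, ← Pi.single_add, add_neg_cancel,
    Pi.single_zero, mul_one]
  rfl

theorem barPlusAll_mem {k n : ℕ} {u : Ext (Laurent k)} (hu : u ∈ ⋀[Laurent k]^n (V (Laurent k))) :
    barPlusAll k u ∈ ⋀[Laurent k]^n (V (Laurent k)) := by
  rw [barPlusAll, List.ofFn_eq_map]
  induction List.finRange k with
  | nil => exact hu
  | cons i l ih =>
    rw [List.map_cons, List.prod_cons, AlgHom.mul_apply]
    exact barPlus_mem _ ih

theorem barPlusAll_act {k n : ℕ} (p : B (Laurent k) n) (u : Ext (Laurent k)) :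
    barPlusAll k (act (Laurent k) n p u) = act (Laurent k) n p (barPlusAll k u) := by
  rw [barPlusAll, List.ofFn_eq_map]
  induction List.finRange k with
  | nil => rfl
  | cons i l ih =>
    rw [List.map_cons, List.prod_cons, AlgHom.mul_apply, ih, barPlus_act, AlgHom.mul_apply]

theorem gammaStarValue_mem (k r : ℕ) (l : Part r) :
    gammaStarValue k r l ∈ ⋀[Laurent k]^(r - k) (V (Laurent k)) := by
  rw [gammaStarValue]
  split_ifs
  · exact barPlusAll_mem (act_mem _ (bWedge_mem_exteriorPower _ _))
  · exact Submodule.zero_mem _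

theorem borderedDet_eq_zero {A : Type} [CommRing A] {k r : ℕ} (h : r < k)
    (M : Matrix (Fin k) (Fin r) A) (v : Fin r → V A) : borderedDet M v = 0 := by
  rw [borderedDet_eq_sum_laplaceTerm]
  refine Finset.sum_eq_zero fun S _ => dif_neg ?_
  have := S.card_le_univ
  rw [Fintype.card_fin] at this
  omega

/-- Giambelli's formula reduces the right side to contracting $\Delta_\lambda(H_{n+k})[\mathbf
b]^{n+k}_0$; the specialization turns $H_{n+k}$ into $\sigma_-(\mathbf w_k)H_n$, and
$\overline\sigma_+(\mathbf w_k)$ commutes with the resulting determinant. -/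
theorem vandermonde_smul_gammaStarValue (k n : ℕ) (l : Part (n + k)) :
    (∏ i : Fin k, ∏ j ∈ Finset.Ioi i, (wPow j 1 - wPow i 1)) • gammaStarValue k (n + k) l =
      (∏ i : Fin k, wPow i 1 ^ (n + k - 1)) •
        contractAll k (fun i => powFunctional (wPow i (-1))) (bWedge (Laurent k) (n + k) l.1) := by
  obtain ⟨φ, h1, h2⟩ := exists_contractAll_act k n fun i : Fin k => wPow i (-1)
  rw [bWedge_eq_act_schurDet, h1 _ _ (bWedge_mem_exteriorPower _ _), map_schurDet, ← map_smul,
    contractAll_bWedge_zero k n _ _ wPow_mul_wPow_neg, map_smul, funext h2, gammaStarValue,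
    if_pos (Nat.le_add_left k n), Nat.add_sub_cancel, barPlusAll_act]
  rfl

end Vertex

end VertexOp

theorem mainTheorem6 (k r : ℕ) (l : VertexOp.Part r) :
    VertexOp.gammaStar k (VertexOp.bWedge (VertexOp.Laurent k) r l.1) ∈
        ⋀[VertexOp.Laurent k]^(r - k) (VertexOp.V (VertexOp.Laurent k)) ∧
      (∏ i : Fin k, ∏ j ∈ Finset.Ioi i, (VertexOp.wPow j 1 - VertexOp.wPow i 1)) •
          VertexOp.gammaStar k (VertexOp.bWedge (VertexOp.Laurent k) r l.1) =
        (∏ i : Fin k, VertexOp.wPow i ((r : ℤ) - 1)) •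
          VertexOp.borderedDet
            (Matrix.of fun (i : Fin k) (j : Fin r) =>
              VertexOp.wPow i (-(VertexOp.expo l.1 j : ℤ)))
            (fun j : Fin r => VertexOp.b (VertexOp.Laurent k) (VertexOp.expo l.1 j)) := by
  rw [VertexOp.gammaStar_bWedge]
  refine ⟨VertexOp.gammaStarValue_mem k r l, ?_⟩
  rcases lt_or_ge r k with h | h
  · rw [VertexOp.borderedDet_eq_zero h, VertexOp.gammaStarValue, if_neg h.not_ge, smul_zero,
      smul_zero]
  · obtain ⟨n, rfl⟩ := Nat.exists_eq_add_of_le' h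
    rw [VertexOp.vandermonde_smul_gammaStarValue, VertexOp.bWedge, VertexOp.contractAll_ιMulti]
    congr 1
    · refine Finset.prod_congr rfl fun i _ => ?_
      -- An index `i : Fin k` forces $n+k\ge1$, so the truncated exponent agrees with the integer
      -- $r-1$; for $k=0$ the product is empty.
      rw [VertexOp.wPow_pow, mul_one, Nat.cast_sub (by have := i.2; omega), Nat.cast_one]
    · congr 1
      refine Matrix.ext fun i j => ?_
      rw [Matrix.of_apply, Matrix.of_apply, VertexOp.powFunctional_b, VertexOp.wPow_pow, mul_neg,
        mul_one]
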